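/- Let $n\ge 2$ and $1\le L\le n+1$. A (generalized) wedge in $\mathbb{R}^{n+1}$ is a closed region $\mathbf{W}=\{x:\langle x,\bar N_i\rangle\le 0,\ i=1,\dots,L\}$, where $\bar N_1,\dots,\bar N_L$ are linearly independent unit vectors; $\bar N_i$ is the outward unit normal to the hyperplane $P_i=\{x:\langle x,\bar N_i\rangle=0\}$, and the origin lies in $\bigcap_i P_i$. Let $\vec\theta_0=(\theta_0^1,\dots,\theta_0^L)\in(0,\pi)^L$, and let $\mathbf{k}_0=\sum_{i=1}^L c_i\bar N_i$ be the unique vector of this form with $\langle \mathbf{k}_0,\bar N_i\rangle=\cos\theta_0^i$ for all $i$. Let $\Sigma\subset\mathbf{W}$ be a smooth, compact, embedded $\vec\theta_0$-capillary hypersurface with smooth unit normal field $\nu$. This means: $\Sigma$ is the closure of its part in the interior of $\mathbf{W}$; near each of its points (points of $\partial\Sigma$, also those on the edges $P_i\cap P_j$, included) $\Sigma$ is the part in $\mathbf{W}$ of a smooth embedded hypersurface with unit normal $\nu$; the field $\nu$ is smooth up to the boundary; and $\Sigma$ meets each $P_i$ at the constant contact angle $\theta_0^i$, i.e. $\langle\nu,\bar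 N_i\rangle=-\cos\theta_0^i$ on $\partial\Sigma\cap P_i=\Sigma\cap P_i$. (If $\Sigma$ together with $\partial\mathbf{W}$ encloses a domain $\Omega$, one takes for $\nu$ the normal pointing out of $\Omega$.) Let $\kappa_1,\dots,\kappa_n$ be the principal curvatures of $\Sigma$, i.e. the eigenvalues of the second fundamental form $h(X,Y)=\langle D_X\nu,Y\rangle$, and let the normalized mean curvatures $H_0=1,H_1,\dots,H_n$ be defined by $\prod_{i=1}^n(1+t\kappa_i)=\sum_{r=0}^n\binom{n}{r}H_r t^r$. Then for every $r=1,\dots,n$ the function $H_{r-1}(1+\langle\nu,\mathbf{k}_0\rangle)-H_r\langle x,\nu\rangle$ is integrable on $\Sigma$ with respect to the $n$-dimensional area measure $dA$, and $$\int_\Sigma\Big(H_{r-1}\big(1+\langle\nu,\mathbf{k}_0\rangle\big)-H_r\langle x,\nu\rangle\Big)\,dA=0 .$$ In particular, if $L=1$ and $\mathbf{W}$ is the closed half-space $\{x: x_{n+1}\ge 0\}$ (so $\bar N_1=-E_{n+1}$, where $E_{n+1}=(0,\dots,0,1)$) with contact angle $\theta_0\in(0,\pi)$, then for every $r=1,\dots,n$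 the corresponding integrand is integrable and $$\int_\Sigma\Big(H_{r-1}\big(1-\cos\theta_0\langle\nu,E_{n+1}\rangle\big)-H_r\langle x,\nu\rangle\Big)\,dA=0 .$$ -/

import Mathlib

open MeasureTheory Set
open scoped RealInnerProductSpace ContDiff Gradient

noncomputable section

/-- The Euclidean space `ℝⁿ⁺¹`. -/
abbrev AmbientSpace (n : ℕ) : Type := EuclideanSpace ℝ (Fin (n + 1))

/-- The data of a (generalized) wedge in `ℝⁿ⁺¹` with `L` faces and with the origin in the
intersection of all its bounding hyperplanes: the outward unit normals `N i` of the hyperplanes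
`P i = {x | ⟪x, N i⟫ = 0}`, which are linearly independent (so that `L ≤ n + 1`). -/
structure Wedge (n L : ℕ) where
  /-- the outward unit normals of the bounding hyperplanes -/
  N : Fin L → AmbientSpace n
  norm_N : ∀ i, ‖N i‖ = 1
  linearIndependent_N : LinearIndependent ℝ N

namespace Wedge

variable {n L : ℕ}

/-- The closed region bounded by the hyperplanes. -/
def region (W : Wedge n L) : Set (AmbientSpace n) := {x | ∀ i, ⟪x, W.N i⟫ ≤ 0}

/-- The `i`-th bounding hyperplane. -/
def hyperplane (W : Wedge n L) (i : Fin L) : Set (AmbientSpace n) := {x | ⟪x, W.N i⟫ = 0}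

/-- The coefficients `c` with `⟪∑ j, c j • N j, N i⟫ = cos (θ i)` for all `i`
(see `Wedge.inner_capillaryVector` and `Wedge.eq_capillaryVector`). -/
def capillaryCoeff (W : Wedge n L) (θ : Fin L → ℝ) : Fin L → ℝ :=
  (Matrix.gram ℝ W.N)⁻¹.mulVec fun i => Real.cos (θ i)

/-- The vector `k₀ = ∑ i, c i • N i` with `⟪k₀, N i⟫ = cos (θ i)` for all `i`. -/
def capillaryVector (W : Wedge n L) (θ : Fin L → ℝ) : AmbientSpace n :=
  ∑ i, W.capillaryCoeff θ i • W.N i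

theorem inner_sum_eq_gram_mulVec (W : Wedge n L) (c : Fin L → ℝ) (i : Fin L) :
    ⟪∑ j, c j • W.N j, W.N i⟫ = (Matrix.gram ℝ W.N).mulVec c i := by
  simp only [sum_inner, real_inner_smul_left, Matrix.mulVec, dotProduct, Matrix.gram_apply]
  refine Finset.sum_congr rfl fun j _ => ?_
  rw [real_inner_comm, mul_comm]

theorem isUnit_det_gram (W : Wedge n L) : IsUnit (Matrix.gram ℝ W.N).det :=
  (Matrix.posDef_gram_of_linearIndependent W.linearIndependent_N).det_pos.ne'.isUnit

theorem inner_capillaryVector (W : Wedge n L) (θ : Fin L → ℝ) (i : Fin L) :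
    ⟪W.capillaryVector θ, W.N i⟫ = Real.cos (θ i) := by
  rw [capillaryVector, inner_sum_eq_gram_mulVec, capillaryCoeff, Matrix.mulVec_mulVec,
    Matrix.mul_nonsing_inv _ W.isUnit_det_gram, Matrix.one_mulVec]

theorem eq_capillaryVector (W : Wedge n L) (θ c : Fin L → ℝ)
    (hc : ∀ i, ⟪∑ j, c j • W.N j, W.N i⟫ = Real.cos (θ i)) :
    ∑ j, c j • W.N j = W.capillaryVector θ := by
  have h : (Matrix.gram ℝ W.N).mulVec c = fun i => Real.cos (θ i) :=
    funext fun i => by rw [← inner_sum_eq_gram_mulVec, hc i]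
  rw [capillaryVector, capillaryCoeff, ← h, Matrix.mulVec_mulVec,
    Matrix.nonsing_inv_mul _ W.isUnit_det_gram, Matrix.one_mulVec]

/-- `S` is a smooth, compact, embedded `θ`-capillary hypersurface in the wedge `W`, and `ν` is
its unit normal field (only the values of `ν` near `S` matter).

* `exists_local_equation`: near each of its points, boundary and corner points included, `S` is
  the part in `W` of the regular zero set of a smooth function `f`, and `ν` is the unit normal
  `∇f / |∇f|` along `S`.
* `subset_closure`: `S` is the closure of its part in the interior of `W`.
* `contDiffOn_normal`: `ν` is smooth on `S`, up to the boundary.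
* `contact_angle`: along `∂S ∩ P i = S ∩ P i` the hypersurface meets `P i` at the angle `θ i`,
  that is, `ν = -cos (θ i) • N i + sin (θ i) • η` for a unit vector `η` orthogonal to `N i`
  (the conormal in `P i`); equivalently, the component of `ν` along `N i` is `-cos (θ i)`. -/
structure IsCapillaryHypersurface (W : Wedge n L) (θ : Fin L → ℝ) (S : Set (AmbientSpace n))
    (ν : AmbientSpace n → AmbientSpace n) : Prop where
  isCompact : IsCompact S
  subset_region : S ⊆ W.region
  subset_closure : S ⊆ closure (S ∩ interior W.region)
  exists_local_equation : ∀ x ∈ S, ∃ (U : Set (AmbientSpace n)) (f : AmbientSpace n → ℝ),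
    IsOpen U ∧ x ∈ U ∧ ContDiffOn ℝ ∞ f U ∧ (∀ y ∈ U, ∇ f y ≠ 0) ∧
      S ∩ U = {y ∈ W.region ∩ U | f y = 0} ∧
      ∀ y ∈ S ∩ U, ν y = ‖∇ f y‖⁻¹ • ∇ f y
  contDiffOn_normal : ∃ V : Set (AmbientSpace n), IsOpen V ∧ S ⊆ V ∧ ContDiffOn ℝ ∞ ν V
  contact_angle : ∀ i, ∀ x ∈ S ∩ W.hyperplane i, ⟪ν x, W.N i⟫ = -Real.cos (θ i)

end Wedge

variable {n : ℕ}

/-- The shape operator `X ↦ D_X ν` of a hypersurface with unit normal field `ν`, on the tangent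
space `(ν x)ᗮ`; the second fundamental form is `h(X, Y) = ⟪D_X ν, Y⟫`.
(The orthogonal projection onto the tangent space does not change `⟪D_X ν, Y⟫`.) -/
def shapeOperator (ν : AmbientSpace n → AmbientSpace n) (x : AmbientSpace n) :
    ((ℝ ∙ ν x)ᗮ : Submodule ℝ (AmbientSpace n)) →ₗ[ℝ]
      ((ℝ ∙ ν x)ᗮ : Submodule ℝ (AmbientSpace n)) :=
  ((ℝ ∙ ν x)ᗮ.orthogonalProjectionOnto ∘L fderiv ℝ ν x ∘L (ℝ ∙ ν x)ᗮ.subtypeL).toLinearMap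

/-- The principal curvatures `κ₁, …, κₙ` at `x`: the eigenvalues, with multiplicity, of the shape
operator. -/
def principalCurvatures (ν : AmbientSpace n → AmbientSpace n) (x : AmbientSpace n) :
    Multiset ℝ :=
  (shapeOperator ν x).charpoly.roots

/-- The normalized `r`-th mean curvature `H_r`, so that
`∏ i, (1 + t κ i) = ∑ r, (n.choose r) * H_r * t ^ r`; in particular `H_0 = 1`. -/
def meanCurvature (r : ℕ) (ν : AmbientSpace n → AmbientSpace n) (x : AmbientSpace n) : ℝ :=
  (principalCurvatures ν x).esymm r / (n.choose r : ℝ)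

/-- The last coordinate vector `E_{n+1}` of `ℝⁿ⁺¹`. -/
def lastBasisVector (n : ℕ) : AmbientSpace n := EuclideanSpace.single (Fin.last n) 1

/-- The closed upper half-space as a wedge with one face, with outward unit normal `-E_{n+1}`. -/
def halfSpaceWedge (n : ℕ) : Wedge n 1 where
  N := fun _ => -lastBasisVector n
  norm_N := fun _ => by simp [lastBasisVector]
  linearIndependent_N := by
    refine linearIndependent_unique_iff.2 ?_
    simp [lastBasisVector]

theorem halfSpaceWedge_region (n : ℕ) :
    (halfSpaceWedge n).region = {x | 0 ≤ x (Fin.last n)} := by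
  ext x
  simp [Wedge.region, halfSpaceWedge, lastBasisVector, EuclideanSpace.inner_single_right]

end

/-! Put `Y = ν + k₀`. The choice of `k₀` makes the contact angle condition read `⟪Y, N i⟫ = 0` on
the face `P i`, so along each face both the position `x` and `Y` are tangent to `P i`; hence so are
`X = x + tY` and `Y`, for every real `t`.

For maps `X`, `Y` on a parameter domain, the expression `-n det (Y; ∂₁X, …, ∂ₙX) + ∑ₖ det (X; ∂₁X,
…, ∂ₖY, …, ∂ₙX)` is the divergence of the field with components `det (X; ∂₁X, …, Y, …, ∂ₙX)`
(`sum_fderiv_detCons_update`). The flux of this field through a face is a determinant of vectors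
that all lie in the hyperplane `P i`, so it is zero. The expression therefore integrates to zero
over the hypersurface (`setIntegral_surfaceMixedDet_eq_zero`).

For `X = x + tY` the derivative along the surface is `1 + t dν`, and the density becomes a
polynomial in `t` whose coefficients are multiples of `H_{i+1} ⟪x, ν⟫ - H_i ⟪Y, ν⟫`
(`surfaceMixedDet_parallel`), where `⟪Y, ν⟫ = 1 + ⟪ν, k₀⟫`. Its integral vanishes for all `t`, hence
so does the integral of each coefficient, and all values of `r` are obtained at once.

The parameter set of a piece of the hypersurface is treated only as a compact set, with no
regularity of its boundary or corners. Instead, `X` and `Y` are composed with a map that sets small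
components along the dual frame of the normals to zero. Near a face point the truncated fields lie
in the hyperplane on a whole neighbourhood, so the flux field can be extended by zero as a `C¹`
field. The truncation is then removed by dominated convergence: the derivatives converge almost
everywhere because the derivative of a function vanishes almost everywhere on its zero set
(`setIntegral_mixedDet_eq_zero`). An area formula for graph charts and a partition of unity carry
the result to the hypersurface. -/

/-- The determinant of `n + 1` vectors of `ℝⁿ⁺¹` with respect to the standard basis. -/
noncomputable def detForm (n : ℕ) : AmbientSpace n [⋀^Fin (n + 1)]→ₗ[ℝ] ℝ :=
  (EuclideanSpace.basisFun (Fin (n + 1)) ℝ).toBasis.det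

theorem detForm_apply (n : ℕ) (v : Fin (n + 1) → AmbientSpace n) :
    detForm n v = (Matrix.of fun i j => v j i).det := rfl

/-- The determinant as a continuous multilinear map. -/
noncomputable def detFormL (n : ℕ) :
    ContinuousMultilinearMap ℝ (fun _ : Fin (n + 1) => AmbientSpace n) ℝ where
  toMultilinearMap := (detForm n).toMultilinearMap
  cont := by
    change Continuous fun v : Fin (n + 1) → AmbientSpace n => detForm n v
    simp only [detForm_apply]
    refine Continuous.matrix_det ?_
    refine continuous_matrix fun i j => ?_
    simp only [Matrix.of_apply]
    fun_prop

theorem detFormL_apply (n : ℕ) (v : Fin (n + 1) → AmbientSpace n) :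
    detFormL n v = detForm n v := rfl

/-! ### Determinants with a distinguished first vector, and the divergence identity -/

section detCons

variable {n : ℕ}

/-- The determinant `det (a, v₁, …, vₙ)`. -/
noncomputable def detCons (a : AmbientSpace n) (v : Fin n → AmbientSpace n) : ℝ :=
  detForm n (Fin.cons a v : Fin (n + 1) → AmbientSpace n)

theorem detCons_add_left (a b : AmbientSpace n) (v : Fin n → AmbientSpace n) :
    detCons (a + b) v = detCons a v + detCons b v :=
  (detForm n).toMultilinearMap.cons_add v a b

theorem detCons_smul_left (c : ℝ) (a : AmbientSpace n) (v : Fin n → AmbientSpace n) :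
    detCons (c • a) v = c * detCons a v :=
  (detForm n).toMultilinearMap.cons_smul v c a

theorem detCons_update_add (a : AmbientSpace n) (v : Fin n → AmbientSpace n) (k : Fin n)
    (x y : AmbientSpace n) :
    detCons a (Function.update v k (x + y)) =
      detCons a (Function.update v k x) + detCons a (Function.update v k y) := by
  simp only [detCons, Fin.cons_update]
  exact (detForm n).map_update_add _ _ _ _

theorem detCons_update_smul (a : AmbientSpace n) (v : Fin n → AmbientSpace n) (k : Fin n)
    (c : ℝ) (x : AmbientSpace n) :
    detCons a (Function.update v k (c • x)) = c * detCons a (Function.update v k x) := by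
  simp only [detCons, Fin.cons_update]
  exact (detForm n).map_update_smul _ _ _ _

theorem detCons_update_zero (a : AmbientSpace n) (v : Fin n → AmbientSpace n) (k : Fin n) :
    detCons a (Function.update v k 0) = 0 := by
  simpa using detCons_update_smul a v k 0 0

theorem detCons_zero_left (v : Fin n → AmbientSpace n) :
    detCons (0 : AmbientSpace n) v = 0 := by
  simpa using detCons_smul_left 0 (0 : AmbientSpace n) v

/-- Exchanging the first vector with one of the others changes the sign. -/
theorem detCons_update_swap (a b : AmbientSpace n) (v : Fin n → AmbientSpace n) (k : Fin n) :
    detCons a (Function.update v k b) = -detCons b (Function.update v k a) := by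
  have h := (detForm n).map_swap (Fin.cons b (Function.update v k a))
    (Fin.succ_ne_zero k).symm
  rw [detCons, detCons, ← h]
  congr 1
  funext i
  refine Fin.cases ?_ (fun j => ?_) i
  · simp
  · by_cases hj : j = k
    · subst hj; simp [-Fin.cons_update]
    · rw [Function.comp_apply, Equiv.swap_apply_of_ne_of_ne (Fin.succ_ne_zero j)
        (fun h => hj (Fin.succ_injective _ h))]
      simp [hj]

/-- Exchanging two of the last `n` vectors changes the sign. -/
theorem detCons_update_update_swap (a x y : AmbientSpace n) (v : Fin n → AmbientSpace n)
    {j k : Fin n} (hjk : j ≠ k) :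
    detCons a (Function.update (Function.update v k x) j y) =
      -detCons a (Function.update (Function.update v j x) k y) := by
  have h := (detForm n).map_swap (Fin.cons a (Function.update (Function.update v j x) k y))
    (fun h => hjk (Fin.succ_injective _ h) : j.succ ≠ k.succ)
  rw [detCons, detCons, ← h]
  congr 1
  funext i
  refine Fin.cases ?_ (fun l => ?_) i
  · rw [Function.comp_apply, Equiv.swap_apply_of_ne_of_ne (Fin.succ_ne_zero j).symm
        (Fin.succ_ne_zero k).symm]
    simp
  · by_cases hj : l = j
    · subst hj; simp
    · by_cases hk : l = k
      · subst hk; simp [-Fin.cons_update, hj, Ne.symm hj]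
      · rw [Function.comp_apply, Equiv.swap_apply_of_ne_of_ne
          (fun h => hj (Fin.succ_injective _ h)) (fun h => hk (Fin.succ_injective _ h))]
        simp [hj, hk]

/-- The determinant of vectors in a common hyperplane vanishes. -/
theorem detCons_eq_zero_of_inner_eq_zero {N a : AmbientSpace n} {v : Fin n → AmbientSpace n}
    (hN : N ≠ 0) (ha : ⟪a, N⟫ = 0) (hv : ∀ k, ⟪v k, N⟫ = 0) : detCons a v = 0 := by
  have hall : ∀ j : Fin (n + 1), ⟪(Fin.cons a v : Fin (n + 1) → AmbientSpace n) j, N⟫ = 0 :=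
    fun j => Fin.cases ha hv j
  -- The coordinates of `N` form a nonzero left null vector of the matrix whose columns are the
  -- given vectors.
  rw [detCons, detForm_apply, ← Matrix.exists_vecMul_eq_zero_iff]
  refine ⟨fun i => N i, fun h => hN ?_, ?_⟩
  · ext i; exact congrFun h i
  · funext j
    have := hall j
    rw [PiLp.inner_apply] at this
    simpa [Matrix.vecMul, dotProduct] using this

theorem contDiff_detCons : ContDiff ℝ ∞
    fun p : AmbientSpace n × (Fin n → AmbientSpace n) => detCons p.1 p.2 := by
  change ContDiff ℝ ∞ fun p : AmbientSpace n × (Fin n → AmbientSpace n) =>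
    detFormL n (Fin.cons p.1 p.2 : Fin (n + 1) → AmbientSpace n)
  refine (detFormL n).contDiff.comp (contDiff_pi.2 fun i => ?_)
  refine Fin.cases ?_ (fun j => ?_) i
  · simpa using contDiff_fst
  · simp only [Fin.cons_succ]
    fun_prop

theorem HasFDerivAt.detCons {G : Type*} [NormedAddCommGroup G] [NormedSpace ℝ G]
    {a : G → AmbientSpace n} {v : Fin n → G → AmbientSpace n}
    {a' : G →L[ℝ] AmbientSpace n} {v' : Fin n → G →L[ℝ] AmbientSpace n} {u : G}
    (ha : HasFDerivAt a a' u) (hv : ∀ j, HasFDerivAt (v j) (v' j) u) (w : G) :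
    fderiv ℝ (fun s => detCons (a s) fun j => v j s) u w =
      detCons (a' w) (fun j => v j u) +
        ∑ j, detCons (a u) (Function.update (fun i => v i u) j (v' j w)) := by
  have h := HasFDerivAt.multilinear_comp (f := detFormL n)
    (g := (Fin.cons a v : Fin (n + 1) → G → AmbientSpace n))
    (g' := (Fin.cons a' v' : Fin (n + 1) → G →L[ℝ] AmbientSpace n)) (x := u)
    (fun i => Fin.cases ha (fun j => hv j) i)
  have hc : ∀ s, (fun i => (Fin.cons a v : Fin (n + 1) → G → AmbientSpace n) i s) =
      Fin.cons (a s) (fun j => v j s) := by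
    intro s
    funext i
    refine Fin.cases ?_ (fun j => ?_) i <;> simp
  simp only [hc, detFormL_apply] at h
  unfold _root_.detCons
  rw [h.fderiv]
  simp [Fin.sum_univ_succ, ContinuousMultilinearMap.toContinuousLinearMap,
    Fin.cons_update, detFormL_apply]

theorem HasDerivAt.detCons {a : ℝ → AmbientSpace n} {v : Fin n → ℝ → AmbientSpace n}
    {a' : AmbientSpace n} {v' : Fin n → AmbientSpace n} {t : ℝ} (ha : HasDerivAt a a' t)
    (hv : ∀ j, HasDerivAt (v j) (v' j) t) :
    HasDerivAt (fun s => detCons (a s) fun j => v j s)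
      (detCons a' (fun j => v j t) +
        ∑ j, detCons (a t) (Function.update (fun i => v i t) j (v' j))) t := by
  have h := HasFDerivAt.detCons ha.hasFDerivAt (fun j => (hv j).hasFDerivAt) 1
  have hd : DifferentiableAt ℝ (fun s => _root_.detCons (a s) fun j => v j s) t :=
    DifferentiableAt.comp t (f := fun s => (a s, fun j => v j s))
      (g := fun p : AmbientSpace n × (Fin n → AmbientSpace n) => _root_.detCons p.1 p.2)
      (contDiff_detCons.differentiable (by simp)).differentiableAt
      (ha.differentiableAt.prodMk (differentiableAt_pi.2 fun j => (hv j).differentiableAt))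
  have h2 := hd.hasFDerivAt.hasDerivAt
  rw [h] at h2
  simpa using h2

theorem ContinuousOn.detCons {T : Type*} [TopologicalSpace T] {s : Set T}
    {a : T → AmbientSpace n} {v : T → Fin n → AmbientSpace n} (ha : ContinuousOn a s)
    (hv : ContinuousOn v s) : ContinuousOn (fun p => detCons (a p) (v p)) s :=
  Continuous.comp_continuousOn
    (g := fun p : AmbientSpace n × (Fin n → AmbientSpace n) => _root_.detCons p.1 p.2)
    (f := fun p => (a p, v p)) contDiff_detCons.continuous (ha.prodMk hv)

theorem Continuous.detCons {T : Type*} [TopologicalSpace T]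
    {a : T → AmbientSpace n} {v : T → Fin n → AmbientSpace n} (ha : Continuous a)
    (hv : Continuous v) : Continuous (fun p => detCons (a p) (v p)) :=
  continuousOn_univ.1 (ContinuousOn.detCons ha.continuousOn hv.continuousOn)

/-- A linear change of the parameters multiplies the determinant of a parametrized frame by its
determinant. -/
theorem detCons_comp (a : AmbientSpace n) (A : EuclideanSpace ℝ (Fin n) →ₗ[ℝ] AmbientSpace n)
    (C : EuclideanSpace ℝ (Fin n) →ₗ[ℝ] EuclideanSpace ℝ (Fin n)) :
    detCons a (fun k => A (C (EuclideanSpace.single k 1))) =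
      LinearMap.det C * detCons a (fun k => A (EuclideanSpace.single k 1)) := by
  -- For fixed `a` this is an alternating `n`-form on an `n`-dimensional space, hence a multiple of
  -- the determinant.
  let f : EuclideanSpace ℝ (Fin n) [⋀^Fin n]→ₗ[ℝ] ℝ :=
    ((detForm n).curryLeft a).compLinearMap A
  let e := (EuclideanSpace.basisFun (Fin n) ℝ).toBasis
  have h1 := f.eq_smul_basis_det e
  have h2 : f (C ∘ e) = LinearMap.det C * f e := by
    conv_lhs => rw [h1]
    rw [AlternatingMap.smul_apply, e.det_comp, e.det_self, smul_eq_mul]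
    ring
  simpa [f, e, Function.comp_def, detCons, Matrix.vecCons] using h2

/-- The integrand `-n det (y; A e₁, …, A eₙ) + ∑ₖ det (x; A e₁, …, B eₖ, …, A eₙ)`: for
`A = dx` and `B = dy` it is a divergence, see `sum_fderiv_detCons_update`. -/
noncomputable def mixedDet (x y : AmbientSpace n)
    (A B : EuclideanSpace ℝ (Fin n) →L[ℝ] AmbientSpace n) : ℝ :=
  -(n : ℝ) * detCons y (fun k => A (EuclideanSpace.single k 1)) +
    ∑ k, detCons x (Function.update (fun j => A (EuclideanSpace.single j 1)) k
      (B (EuclideanSpace.single k 1)))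

theorem mixedDet_zero (x : AmbientSpace n) (A : EuclideanSpace ℝ (Fin n) →L[ℝ] AmbientSpace n) :
    mixedDet x 0 A 0 = 0 := by
  simp [mixedDet, detCons_zero_left, detCons_update_zero]

theorem mixedDet_add (x y y' : AmbientSpace n)
    (A B B' : EuclideanSpace ℝ (Fin n) →L[ℝ] AmbientSpace n) :
    mixedDet x (y + y') A (B + B') = mixedDet x y A B + mixedDet x y' A B' := by
  simp only [mixedDet, detCons_add_left, add_apply, detCons_update_add,
    Finset.sum_add_distrib]
  ring

theorem mixedDet_sum {ι : Type*} (s : Finset ι) (x : AmbientSpace n) (y : ι → AmbientSpace n)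
    (A : EuclideanSpace ℝ (Fin n) →L[ℝ] AmbientSpace n)
    (B : ι → EuclideanSpace ℝ (Fin n) →L[ℝ] AmbientSpace n) :
    mixedDet x (∑ i ∈ s, y i) A (∑ i ∈ s, B i) = ∑ i ∈ s, mixedDet x (y i) A (B i) := by
  classical
  induction s using Finset.induction_on with
  | empty => simp [mixedDet_zero]
  | insert i s hi ih => rw [Finset.sum_insert hi, Finset.sum_insert hi, Finset.sum_insert hi,
      mixedDet_add, ih]

theorem hasDerivAt_detCons_add_smul (x y : AmbientSpace n) (v w : Fin n → AmbientSpace n)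
    (t : ℝ) :
    HasDerivAt (fun s : ℝ => detCons (x + s • y) fun k => v k + s • w k)
      (detCons y (fun k => v k + t • w k) +
        ∑ k, detCons (x + t • y) (Function.update (fun j => v j + t • w j) k (w k))) t := by
  have h : ∀ a b : AmbientSpace n, HasDerivAt (fun s : ℝ => a + s • b) b t := fun a b => by
    simpa using ((hasDerivAt_id t).smul_const b).const_add a
  exact HasDerivAt.detCons (v := fun k s => v k + s • w k) (h x y) fun k => h (v k) (w k)

/-- The sum in `mixedDet` is the derivative at `s = 0` of `det (x; (A + sB) e₁, …, (A + sB) eₙ)`, so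
it inherits the transformation law of the determinant; the remaining term obeys that law directly.
-/
theorem mixedDet_comp (x y : AmbientSpace n)
    (A B : EuclideanSpace ℝ (Fin n) →L[ℝ] AmbientSpace n)
    (C : EuclideanSpace ℝ (Fin n) →L[ℝ] EuclideanSpace ℝ (Fin n)) :
    mixedDet x y (A ∘L C) (B ∘L C) = LinearMap.det C.toLinearMap * mixedDet x y A B := by
  have h1 := hasDerivAt_detCons_add_smul x 0 (fun k => A (C (EuclideanSpace.single k 1)))
    (fun k => B (C (EuclideanSpace.single k 1))) 0
  have h2 := (hasDerivAt_detCons_add_smul x 0 (fun k => A (EuclideanSpace.single k 1))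
    (fun k => B (EuclideanSpace.single k 1)) 0).const_mul (LinearMap.det C.toLinearMap)
  have h3 : ∀ s : ℝ, detCons (x + s • (0 : AmbientSpace n)) (fun k =>
      A (C (EuclideanSpace.single k 1)) + s • B (C (EuclideanSpace.single k 1))) =
      LinearMap.det C.toLinearMap * detCons (x + s • (0 : AmbientSpace n)) (fun k =>
        A (EuclideanSpace.single k 1) + s • B (EuclideanSpace.single k 1)) := fun s =>
    detCons_comp (x + s • (0 : AmbientSpace n)) (A + s • B).toLinearMap
      C.toLinearMap
  simp only [h3] at h1
  have h4 := h1.unique h2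
  simp only [zero_smul, add_zero, detCons_zero_left, zero_add] at h4
  have h5 := detCons_comp y A.toLinearMap C.toLinearMap
  simp only [ContinuousLinearMap.coe_coe] at h5
  simp only [mixedDet, ContinuousLinearMap.comp_apply, h4, h5]
  ring

/-- The divergence of the vector field with components
`det (X; ∂₁X, …, Y, …, ∂ₙX)`, with `Y` in the place of `∂ₖX`. -/
theorem sum_fderiv_detCons_update {X Y : EuclideanSpace ℝ (Fin n) → AmbientSpace n}
    {u : EuclideanSpace ℝ (Fin n)} (hX : ContDiffAt ℝ 2 X u) (hY : DifferentiableAt ℝ Y u) :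
    ∑ k, fderiv ℝ (fun v => detCons (X v) (Function.update
        (fun j => fderiv ℝ X v (EuclideanSpace.single j 1)) k (Y v))) u
          (EuclideanSpace.single k 1) =
      mixedDet (X u) (Y u) (fderiv ℝ X u) (fderiv ℝ Y u) := by
  set e : Fin n → EuclideanSpace ℝ (Fin n) := fun k => EuclideanSpace.single k 1 with he
  have hX1 : HasFDerivAt X (fderiv ℝ X u) u := (hX.differentiableAt (by simp)).hasFDerivAt
  have hX2 : HasFDerivAt (fderiv ℝ X) (fderiv ℝ (fderiv ℝ X) u) u :=
    ((hX.fderiv_right (m := 1) (by norm_num)).differentiableAt (by simp)).hasFDerivAt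
  have hsymm : ∀ v w, fderiv ℝ (fderiv ℝ X) u v w = fderiv ℝ (fderiv ℝ X) u w v :=
    fun v w => (hX.isSymmSndFDerivAt (by simp)).eq v w
  let V : Fin n → Fin n → EuclideanSpace ℝ (Fin n) → AmbientSpace n := fun k j v =>
    if j = k then Y v else fderiv ℝ X v (e j)
  let V' : Fin n → Fin n → EuclideanSpace ℝ (Fin n) →L[ℝ] AmbientSpace n := fun k j =>
    if j = k then fderiv ℝ Y u else (fderiv ℝ (fderiv ℝ X) u).flip (e j)
  have hV : ∀ k j, HasFDerivAt (V k j) (V' k j) u := by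
    intro k j
    by_cases hjk : j = k
    · simpa [V, V', hjk] using hY.hasFDerivAt
    · simp only [V, V', hjk, if_false]
      simpa using hX2.clm_apply (hasFDerivAt_const (e j) u)
  have hVupd : ∀ k v, (fun j => V k j v) =
      Function.update (fun j => fderiv ℝ X v (e j)) k (Y v) := by
    intro k v
    funext j
    by_cases hjk : j = k
    · subst hjk; simp [V]
    · simp [V, hjk]
  -- These are the terms containing second derivatives of `X`. They are antisymmetric in `(k, j)`,
  -- since the determinant changes sign under exchange and the second derivative is symmetric, so
  -- their total is zero.
  let S : Fin n → Fin n → ℝ := fun k j => if j = k then 0 else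
    detCons (X u) (Function.update (Function.update (fun j => fderiv ℝ X u (e j)) k (Y u)) j
      (fderiv ℝ (fderiv ℝ X) u (e k) (e j)))
  have hS : ∀ k j, S k j = -S j k := by
    intro k j
    by_cases hjk : j = k
    · simp [S, hjk]
    · simp only [S, hjk, Ne.symm hjk, if_false]
      rw [detCons_update_update_swap _ _ _ _ hjk, hsymm]
  have hSsum : ∑ k, ∑ j, S k j = 0 := by
    have h : ∑ k, ∑ j, S k j = -∑ k, ∑ j, S k j := by
      conv_lhs => rw [Finset.sum_comm]
      simp only [← Finset.sum_neg_distrib]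
      exact Finset.sum_congr rfl fun k _ => Finset.sum_congr rfl fun j _ => hS j k
    linarith
  -- Differentiating the first entry gives `det (∂ₖX; …, Y, …)`; exchanging `∂ₖX` with `Y` turns it
  -- into the same term `-det (Y; ∂₁X, …, ∂ₙX)` for every `k`, which accounts for the factor `-n`.
  have hk : ∀ k, fderiv ℝ (fun v => detCons (X v) (Function.update
      (fun j => fderiv ℝ X v (e j)) k (Y v))) u (e k) =
      -detCons (Y u) (fun j => fderiv ℝ X u (e j)) +
        (detCons (X u) (Function.update (fun j => fderiv ℝ X u (e j)) k (fderiv ℝ Y u (e k))) +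
          ∑ j, S k j) := by
    intro k
    have h := HasFDerivAt.detCons hX1 (hV k) (e k)
    simp only [hVupd] at h
    rw [h, detCons_update_swap,
      Function.update_eq_self_iff.2 (rfl : fderiv ℝ X u (e k) = (fun j => fderiv ℝ X u (e j)) k)]
    congr 1
    rw [← Finset.add_sum_erase _ _ (Finset.mem_univ k),
      ← Finset.add_sum_erase _ (fun j => S k j) (Finset.mem_univ k)]
    have hSk : S k k = 0 := by simp [S]
    rw [hSk, zero_add]
    congr 1
    · simp [V']
    · refine Finset.sum_congr rfl fun j hj => ?_
      have hjk := Finset.ne_of_mem_erase hj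
      simp [V', S, hjk]
  simp only [he] at hk
  rw [Finset.sum_congr rfl fun k _ => hk k, Finset.sum_add_distrib, Finset.sum_add_distrib, hSsum,
    mixedDet]
  simp

end detCons

/-! ### The divergence theorem when the field can be cut off smoothly -/

section Divergence

variable {n : ℕ}

/-- Integration by parts against the constant function `1`. -/
theorem integral_fderiv_apply_eq_zero {E : Type*} [NormedAddCommGroup E] [NormedSpace ℝ E]
    [FiniteDimensional ℝ E] [MeasurableSpace E] [BorelSpace E] {μ : Measure E}
    [μ.IsAddHaarMeasure] {W : E → ℝ} (hW : ContDiff ℝ 1 W) (hc : HasCompactSupport W) (v : E) :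
    ∫ u, fderiv ℝ W u v ∂μ = 0 := by
  have h1 : Integrable (fun u => fderiv ℝ W u v) μ :=
    ((hW.continuous_fderiv (by simp)).clm_apply continuous_const).integrable_of_hasCompactSupport
      (hc.fderiv_apply ℝ v)
  have h := integral_mul_fderiv_eq_neg_fderiv_mul_of_integrable (μ := μ) (f := fun _ : E => (1 : ℝ))
    (g := W) (v := v) (by simp) (by simpa using h1)
    (by simpa using hW.continuous.integrable_of_hasCompactSupport hc)
    (fun _ _ => by fun_prop) (fun x _ => hW.differentiable (by simp) x)
  simpa using h

/-- If the flux field of `X` and `Y` can be cut off along a compact set `K` because `Y` vanishes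
outside `K`, or because `X` and `Y` stay in a common hyperplane, then its divergence has
integral zero over `K`. -/
theorem setIntegral_mixedDet_eq_zero_of_eventually {K : Set (EuclideanSpace ℝ (Fin n))}
    (hK : IsCompact K) {X Y : EuclideanSpace ℝ (Fin n) → AmbientSpace n}
    (hX : ∀ u ∈ K, ContDiffAt ℝ 2 X u) (hY : ∀ u ∈ K, ContDiffAt ℝ 1 Y u)
    (h : ∀ u ∈ K, (∀ᶠ v in nhds u, v ∉ K → Y v = 0) ∨
      ∃ N : AmbientSpace n, N ≠ 0 ∧ ∀ᶠ v in nhds u, ⟪X v, N⟫ = 0 ∧ ⟪Y v, N⟫ = 0) :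
    ∫ u in K, mixedDet (X u) (Y u) (fderiv ℝ X u) (fderiv ℝ Y u) = 0 := by
  set e : Fin n → EuclideanSpace ℝ (Fin n) := fun k => EuclideanSpace.single k 1 with he
  let Z : Fin n → EuclideanSpace ℝ (Fin n) → ℝ := fun k v =>
    detCons (X v) (Function.update (fun j => fderiv ℝ X v (e j)) k (Y v))
  let W : Fin n → EuclideanSpace ℝ (Fin n) → ℝ := fun k => K.indicator (Z k)
  have hZ : ∀ k, ∀ u ∈ K, ContDiffAt ℝ 1 (Z k) u := by
    intro k u hu
    have hX' : ContDiffAt ℝ 1 (fderiv ℝ X) u := (hX u hu).fderiv_right (by norm_num)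
    refine ContDiffAt.comp u
      (f := fun v => (X v, Function.update (fun j => fderiv ℝ X v (e j)) k (Y v)))
      (g := fun p : AmbientSpace n × (Fin n → AmbientSpace n) => detCons p.1 p.2)
      (contDiff_detCons.contDiffAt.of_le (by simp)) ?_
    refine ((hX u hu).of_le (by norm_num)).prodMk (contDiffAt_pi.2 fun j => ?_)
    by_cases hj : j = k
    · subst hj; simpa using hY u hu
    · simpa [hj] using hX'.clm_apply contDiffAt_const
  -- Cutting off does not change the field near points of `K`: outside `K` it is already zero,
  -- either because `Y` is, or because `X`, `Y` and all derivatives of `X` lie in one hyperplane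
  -- there. Thus the cut-off field is `C¹` whatever the boundary of `K` looks like.
  have hWZ : ∀ k, ∀ u ∈ K, W k =ᶠ[nhds u] Z k := by
    intro k u hu
    rcases h u hu with h | ⟨N, hN, h⟩
    · filter_upwards [h] with v hv
      by_cases hvK : v ∈ K
      · simp [W, hvK]
      · simp [W, Z, hvK, hv hvK, detCons_update_zero]
    · filter_upwards [eventually_eventually_nhds.2 h,
        ((hX u hu).eventually (by simp))] with v hv hvX
      have hd : ∀ w, ⟪fderiv ℝ X v w, N⟫ = 0 := by
        intro w
        have h1 : HasFDerivAt (fun x => ⟪X x, N⟫) _ v :=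
          ((hvX.differentiableAt (by simp)).hasFDerivAt).inner ℝ (hasFDerivAt_const N v)
        have h2 : (fun x => ⟪X x, N⟫) =ᶠ[nhds v] fun _ => (0 : ℝ) := hv.mono fun x hx => hx.1
        have h3 := (h1.congr_of_eventuallyEq h2.symm).unique (hasFDerivAt_const (0 : ℝ) v)
        simpa using congrArg (fun L => L w) h3
      have hz : Z k v = 0 := by
        refine detCons_eq_zero_of_inner_eq_zero hN hv.self_of_nhds.1 fun j => ?_
        by_cases hj : j = k
        · subst hj; simpa using hv.self_of_nhds.2
        · simpa [hj] using hd (e j)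
      by_cases hvK : v ∈ K
      · simp [W, hvK]
      · simp [W, hvK, hz]
  have hW0 : ∀ k, ∀ u ∉ K, W k =ᶠ[nhds u] fun _ => 0 := by
    intro k u hu
    filter_upwards [hK.isClosed.isOpen_compl.mem_nhds hu] with v hv
    exact indicator_of_notMem hv _
  have hWC : ∀ k, ContDiff ℝ 1 (W k) := fun k => contDiff_iff_contDiffAt.2 fun u => by
    by_cases hu : u ∈ K
    · exact (hZ k u hu).congr_of_eventuallyEq (hWZ k u hu)
    · exact contDiffAt_const.congr_of_eventuallyEq (hW0 k u hu)
  have hWc : ∀ k, HasCompactSupport (W k) := fun k =>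
    HasCompactSupport.intro hK fun x hx => indicator_of_notMem hx _
  have hsum : ∀ u, ∑ k, fderiv ℝ (W k) u (e k) =
      K.indicator (fun u => mixedDet (X u) (Y u) (fderiv ℝ X u) (fderiv ℝ Y u)) u := by
    intro u
    by_cases hu : u ∈ K
    · rw [indicator_of_mem hu, ← sum_fderiv_detCons_update (hX u hu)
        ((hY u hu).differentiableAt (by simp))]
      exact Finset.sum_congr rfl fun k _ => by rw [(hWZ k u hu).fderiv_eq]
    · rw [indicator_of_notMem hu]
      exact Finset.sum_eq_zero fun k _ => by rw [(hW0 k u hu).fderiv_eq]; simp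
  rw [← integral_indicator hK.measurableSet, ← funext hsum, integral_finsetSum]
  · exact Finset.sum_eq_zero fun k _ => integral_fderiv_apply_eq_zero (hWC k) (hWc k) _
  · intro k _
    exact (((hWC k).continuous_fderiv (by simp)).clm_apply
      continuous_const).integrable_of_hasCompactSupport ((hWc k).fderiv_apply ℝ (e k))

end Divergence

/-! ### Truncation of small normal components, and the divergence theorem with tangency on `K` only
-/

section Truncation

attribute [local irreducible] detCons mixedDet

/-- A smooth function that is the identity near `0` and vanishes away from `0`. -/
noncomputable def cutoffId (s : ℝ) : ℝ :=
  s * (⟨1, 2, one_pos, one_lt_two⟩ : ContDiffBump (0 : ℝ)) s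

theorem contDiff_cutoffId : ContDiff ℝ ∞ cutoffId :=
  contDiff_id.mul (ContDiffBump.contDiff _)

theorem cutoffId_of_abs_le {s : ℝ} (hs : |s| ≤ 1) : cutoffId s = s := by
  rw [cutoffId, ContDiffBump.one_of_mem_closedBall, mul_one]
  simpa using hs

theorem cutoffId_of_le_abs {s : ℝ} (hs : 2 ≤ |s|) : cutoffId s = 0 := by
  rw [cutoffId, ContDiffBump.zero_of_le_dist, mul_zero]
  simpa using hs

theorem deriv_cutoffId_of_lt_abs {s : ℝ} (hs : 2 < |s|) : deriv cutoffId s = 0 := by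
  have h : cutoffId =ᶠ[nhds s] fun _ => 0 := by
    filter_upwards [(isOpen_lt continuous_const continuous_abs).mem_nhds hs] with x hx
    exact cutoffId_of_le_abs (le_of_lt hx)
  rw [h.deriv_eq, deriv_const]

theorem abs_cutoffId_le (s : ℝ) : |cutoffId s| ≤ 2 := by
  by_cases hs : 2 ≤ |s|
  · simp [cutoffId_of_le_abs hs]
  · rw [cutoffId, abs_mul, abs_of_nonneg (ContDiffBump.nonneg _)]
    have h := (⟨1, 2, one_pos, one_lt_two⟩ : ContDiffBump (0 : ℝ)).le_one (x := s)
    have h0 := (⟨1, 2, one_pos, one_lt_two⟩ : ContDiffBump (0 : ℝ)).nonneg (x := s)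
    push Not at hs
    nlinarith [abs_nonneg s]

theorem exists_abs_deriv_cutoffId_le : ∃ C : ℝ, ∀ s, |deriv cutoffId s| ≤ C := by
  have hc : HasCompactSupport (deriv cutoffId) :=
    HasCompactSupport.intro (isCompact_Icc (a := (-2 : ℝ)) (b := 2)) fun x hx =>
      deriv_cutoffId_of_lt_abs (by
        rw [mem_Icc, ← abs_le] at hx
        exact not_le.1 hx)
  exact hc.exists_bound_of_continuous (contDiff_cutoffId.continuous_deriv (by simp))

variable {n L : ℕ}

/-- The map of `ℝⁿ⁺¹` that replaces the components `⟪x, N i⟫` that are small compared to `δ`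
by zero; the vectors `M i` are dual to the vectors `N i`. -/
noncomputable def truncation (N M : Fin L → AmbientSpace n) (δ : ℝ) (x : AmbientSpace n) :
    AmbientSpace n :=
  x - ∑ i, (δ * cutoffId (⟪N i, x⟫ / δ)) • M i

/-- The derivative at a point with value `x` and derivative `A` of a truncated map. -/
noncomputable def truncationDeriv {E : Type*} [NormedAddCommGroup E] [NormedSpace ℝ E]
    (N M : Fin L → AmbientSpace n) (δ : ℝ) (x : AmbientSpace n) (A : E →L[ℝ] AmbientSpace n) :
    E →L[ℝ] AmbientSpace n :=
  A - ∑ i, deriv cutoffId (⟪N i, x⟫ / δ) • ((innerSL ℝ (N i)).comp A).smulRight (M i)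

theorem contDiff_truncation (N M : Fin L → AmbientSpace n) (δ : ℝ) :
    ContDiff ℝ ∞ (truncation N M δ) := by
  refine contDiff_id.sub (ContDiff.sum fun i _ => ContDiff.fun_smul ?_ contDiff_const)
  refine contDiff_const.mul (contDiff_cutoffId.comp (ContDiff.div_const ?_ _))
  exact contDiff_const.inner ℝ contDiff_id

theorem truncation_zero (N M : Fin L → AmbientSpace n) (δ : ℝ) : truncation N M δ 0 = 0 := by
  simp [truncation, cutoffId]

/-- In the range `|s| ≤ 1` the cutoff is the identity, so the whole `i`-th component is subtracted;
by duality the other summands do not contribute to it. -/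
theorem inner_truncation_eq_zero {N M : Fin L → AmbientSpace n}
    (hMN : ∀ i j, ⟪M i, N j⟫ = if i = j then 1 else 0) {δ : ℝ} (hδ : 0 < δ)
    {x : AmbientSpace n} {i : Fin L} (hx : |⟪x, N i⟫| < δ) :
    ⟪truncation N M δ x, N i⟫ = 0 := by
  rw [truncation, inner_sub_left, sum_inner]
  simp only [real_inner_smul_left, hMN]
  rw [Finset.sum_eq_single i (by simp +contextual) (by simp)]
  have h : |⟪N i, x⟫ / δ| ≤ 1 := by
    rw [abs_div, abs_of_pos hδ, div_le_one hδ, real_inner_comm]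
    exact hx.le
  rw [cutoffId_of_abs_le h, real_inner_comm]
  field_simp
  simp

theorem HasFDerivAt.truncation {E : Type*} [NormedAddCommGroup E] [NormedSpace ℝ E]
    (N M : Fin L → AmbientSpace n) {δ : ℝ} (hδ : δ ≠ 0) {X : E → AmbientSpace n}
    {X' : E →L[ℝ] AmbientSpace n} {u : E} (hX : HasFDerivAt X X' u) :
    HasFDerivAt (fun v => truncation N M δ (X v)) (truncationDeriv N M δ (X u) X') u := by
  refine hX.sub (HasFDerivAt.fun_sum fun i _ => ?_)
  have h1 : HasFDerivAt (fun v => ⟪N i, X v⟫) ((innerSL ℝ (N i)).comp X') u :=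
    (innerSL ℝ (N i)).hasFDerivAt.comp u hX
  have h2 : HasDerivAt (fun s => δ * cutoffId (s / δ)) (deriv cutoffId (⟪N i, X u⟫ / δ))
      ⟪N i, X u⟫ := by
    have h := ((contDiff_cutoffId.differentiable (by simp) (⟪N i, X u⟫ / δ)).hasDerivAt.comp
      ⟪N i, X u⟫ ((hasDerivAt_id _).div_const δ)).const_mul δ
    refine h.congr_deriv ?_
    field_simp
  have h3 := (h2.comp_hasFDerivAt u h1).smul_const (M i)
  refine h3.congr_fderiv ?_
  ext v
  simp [smul_smul]

theorem norm_truncation_le (N M : Fin L → AmbientSpace n) {δ : ℝ} (hδ : 0 ≤ δ)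
    (x : AmbientSpace n) :
    ‖truncation N M δ x - x‖ ≤ δ * (2 * ∑ i, ‖M i‖) := by
  rw [truncation, sub_sub_cancel_left, norm_neg, Finset.mul_sum, Finset.mul_sum]
  refine (norm_sum_le _ _).trans (Finset.sum_le_sum fun i _ => ?_)
  rw [norm_smul, Real.norm_eq_abs, abs_mul, abs_of_nonneg hδ, mul_assoc]
  gcongr
  exact abs_cutoffId_le _

/-- The bound is uniform in `δ`: the outer factor `δ` cancels the `1 / δ` from the chain rule. This
provides the domination in the limit `δ → 0`. -/
theorem norm_truncationDeriv_le {E : Type*} [NormedAddCommGroup E] [NormedSpace ℝ E]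
    (N M : Fin L → AmbientSpace n) {C : ℝ} (hC : ∀ s, |deriv cutoffId s| ≤ C) (δ : ℝ)
    (x : AmbientSpace n) (A : E →L[ℝ] AmbientSpace n) :
    ‖truncationDeriv N M δ x A - A‖ ≤ C * (∑ i, ‖N i‖ * ‖M i‖) * ‖A‖ := by
  rw [truncationDeriv, sub_sub_cancel_left, norm_neg, Finset.mul_sum, Finset.sum_mul]
  refine (norm_sum_le _ _).trans (Finset.sum_le_sum fun i _ => ?_)
  have hC0 : 0 ≤ C := (abs_nonneg _).trans (hC 0)
  rw [norm_smul, Real.norm_eq_abs, ContinuousLinearMap.norm_smulRight_apply]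
  have h := ContinuousLinearMap.opNorm_comp_le (innerSL ℝ (N i)) A
  rw [innerSL_apply_norm] at h
  calc _ ≤ C * ((‖N i‖ * ‖A‖) * ‖M i‖) := by gcongr; exact hC _
    _ = _ := by ring

/-- The derivative of a function vanishes almost everywhere on its zero set. -/
theorem ae_fderiv_eq_zero_of_eqOn_zero {E : Type*} [NormedAddCommGroup E] [NormedSpace ℝ E]
    [FiniteDimensional ℝ E] [MeasurableSpace E] [BorelSpace E] (μ : Measure E)
    [μ.IsAddHaarMeasure] {c : E → ℝ} {s : Set E} (hs : MeasurableSet s)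
    (hc : ∀ x ∈ s, DifferentiableAt ℝ c x) (h0 : ∀ x ∈ s, c x = 0) :
    ∀ᵐ x ∂μ.restrict s, fderiv ℝ c x = 0 := by
  rcases subsingleton_or_nontrivial E with hE | hE
  · exact Filter.Eventually.of_forall fun x => Subsingleton.elim _ _
  obtain ⟨e, he⟩ := exists_ne (0 : E)
  -- On its zero set `c` is approximated by the zero map with constant `0`, which bounds the
  -- derivative by `0` almost everywhere. The factor `e` only serves to obtain a map from `E` to
  -- itself.
  have happ : ApproximatesLinearOn (fun x => c x • e) (0 : E →L[ℝ] E) s 0 := by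
    intro x hx y hy
    simp [h0 x hx, h0 y hy]
  have h := happ.norm_fderiv_sub_le μ hs (fun x => (fderiv ℝ c x).smulRight e) fun x hx =>
    ((hc x hx).hasFDerivAt.smul_const e).hasFDerivWithinAt
  filter_upwards [h] with x hx
  have h1 : fderiv ℝ c x = 0 ∨ e = 0 := by simpa using hx
  exact h1.resolve_right he

theorem Continuous.mixedDet {T : Type*} [TopologicalSpace T] {x y : T → AmbientSpace n}
    {A B : T → EuclideanSpace ℝ (Fin n) →L[ℝ] AmbientSpace n} (hx : Continuous x)
    (hy : Continuous y) (hA : Continuous A) (hB : Continuous B) :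
    Continuous fun p => mixedDet (x p) (y p) (A p) (B p) := by
  have hA' : Continuous fun p k => A p (EuclideanSpace.single k 1) :=
    continuous_pi fun k => hA.clm_apply continuous_const
  unfold _root_.mixedDet
  exact (continuous_const.mul (Continuous.detCons hy hA')).add (continuous_finsetSum _ fun k _ =>
    Continuous.detCons hx (Continuous.update hA' k (hB.clm_apply continuous_const)))

theorem tendsto_mixedDet {T : Type*} {l : Filter T} {x y : T → AmbientSpace n}
    {A B : T → EuclideanSpace ℝ (Fin n) →L[ℝ] AmbientSpace n} {x₀ y₀ : AmbientSpace n}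
    {A₀ B₀ : EuclideanSpace ℝ (Fin n) →L[ℝ] AmbientSpace n} (hx : Filter.Tendsto x l (nhds x₀))
    (hy : Filter.Tendsto y l (nhds y₀)) (hA : Filter.Tendsto A l (nhds A₀))
    (hB : Filter.Tendsto B l (nhds B₀)) :
    Filter.Tendsto (fun p => mixedDet (x p) (y p) (A p) (B p)) l
      (nhds (mixedDet x₀ y₀ A₀ B₀)) := by
  have h : Continuous fun p : (AmbientSpace n × AmbientSpace n) ×
      ((EuclideanSpace ℝ (Fin n) →L[ℝ] AmbientSpace n) ×
        (EuclideanSpace ℝ (Fin n) →L[ℝ] AmbientSpace n)) =>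
      mixedDet p.1.1 p.1.2 p.2.1 p.2.2 :=
    Continuous.mixedDet (continuous_fst.comp continuous_fst) (continuous_snd.comp continuous_fst)
      (continuous_fst.comp continuous_snd) (continuous_snd.comp continuous_snd)
  have h2 : Filter.Tendsto (fun p : (AmbientSpace n × AmbientSpace n) ×
      ((EuclideanSpace ℝ (Fin n) →L[ℝ] AmbientSpace n) ×
        (EuclideanSpace ℝ (Fin n) →L[ℝ] AmbientSpace n)) =>
      mixedDet p.1.1 p.1.2 p.2.1 p.2.2) (nhds ((x₀, y₀), (A₀, B₀)))
      (nhds (mixedDet x₀ y₀ A₀ B₀)) := h.tendsto _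
  exact h2.comp ((hx.prodMk_nhds hy).prodMk_nhds (hA.prodMk_nhds hB))

theorem ContinuousOn.mixedDet {T : Type*} [TopologicalSpace T] {s : Set T}
    {x y : T → AmbientSpace n} {A B : T → EuclideanSpace ℝ (Fin n) →L[ℝ] AmbientSpace n}
    (hx : ContinuousOn x s) (hy : ContinuousOn y s) (hA : ContinuousOn A s)
    (hB : ContinuousOn B s) :
    ContinuousOn (fun p => mixedDet (x p) (y p) (A p) (B p)) s :=
  fun p hp => tendsto_mixedDet (hx p hp) (hy p hp) (hA p hp) (hB p hp)

theorem exists_abs_mixedDet_le (n : ℕ) (R : ℝ) : ∃ D, ∀ (x y : AmbientSpace n)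
    (A B : EuclideanSpace ℝ (Fin n) →L[ℝ] AmbientSpace n), ‖x‖ ≤ R → ‖y‖ ≤ R → ‖A‖ ≤ R →
    ‖B‖ ≤ R → ‖mixedDet x y A B‖ ≤ D := by
  have hp : ProperSpace (EuclideanSpace ℝ (Fin n) →L[ℝ] AmbientSpace n) :=
    FiniteDimensional.proper ℝ _
  have hc := ((isCompact_closedBall (0 : AmbientSpace n) R).prod
    (isCompact_closedBall (0 : AmbientSpace n) R)).prod
    ((isCompact_closedBall (0 : EuclideanSpace ℝ (Fin n) →L[ℝ] AmbientSpace n) R).prod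
    (isCompact_closedBall (0 : EuclideanSpace ℝ (Fin n) →L[ℝ] AmbientSpace n) R))
  obtain ⟨D, hD⟩ := hc.exists_bound_of_continuousOn (f := fun p => mixedDet p.1.1 p.1.2 p.2.1 p.2.2)
    (Continuous.mixedDet (continuous_fst.comp continuous_fst)
      (continuous_snd.comp continuous_fst) (continuous_fst.comp continuous_snd)
      (continuous_snd.comp continuous_snd)).continuousOn
  refine ⟨D, fun x y A B hx hy hA hB => hD ((x, y), (A, B)) ⟨⟨?_, ?_⟩, ⟨?_, ?_⟩⟩⟩ <;>
    simpa using ‹_›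

theorem continuousOn_truncationDeriv {T E : Type*} [TopologicalSpace T] [NormedAddCommGroup E]
    [NormedSpace ℝ E] (N M : Fin L → AmbientSpace n) (δ : ℝ) {s : Set T} {x : T → AmbientSpace n}
    {A : T → E →L[ℝ] AmbientSpace n} (hx : ContinuousOn x s) (hA : ContinuousOn A s) :
    ContinuousOn (fun u => truncationDeriv N M δ (x u) (A u)) s := by
  refine hA.sub (continuousOn_finsetSum _ fun i _ => ContinuousOn.fun_smul ?_ ?_)
  · exact (contDiff_cutoffId.continuous_deriv (by simp)).comp_continuousOn
      ((continuousOn_const.inner hx).div_const _)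
  · exact (((ContinuousLinearMap.smulRightL ℝ E (AmbientSpace n)).flip (M i)).continuous.comp
      ((ContinuousLinearMap.compL ℝ _ _ _ (innerSL ℝ (N i))).continuous)).comp_continuousOn hA

theorem tendsto_truncation (N M : Fin L → AmbientSpace n) {δ : ℕ → ℝ} (hδ0 : ∀ m, 0 < δ m)
    (hδt : Filter.Tendsto δ Filter.atTop (nhds 0)) (x : AmbientSpace n) :
    Filter.Tendsto (fun m => truncation N M (δ m) x) Filter.atTop (nhds x) := by
  rw [tendsto_iff_norm_sub_tendsto_zero]
  refine squeeze_zero (fun _ => norm_nonneg _)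
    (fun m => norm_truncation_le N M (hδ0 m).le x) ?_
  simpa using hδt.mul_const (2 * ∑ i, ‖M i‖)

/-- The sequence is eventually constant. If `⟪N i, x⟫ ≠ 0`, then `⟪N i, x⟫ / δ` eventually leaves
the support of the cutoff; if it is zero, the correction vanishes by the hypothesis on `A`, which
`ae_innerSL_comp_fderiv_eq_zero` supplies at almost every point. -/
theorem tendsto_truncationDeriv {E : Type*} [NormedAddCommGroup E] [NormedSpace ℝ E]
    (N M : Fin L → AmbientSpace n) {δ : ℕ → ℝ} (hδ0 : ∀ m, 0 < δ m)
    (hδt : Filter.Tendsto δ Filter.atTop (nhds 0)) {x : AmbientSpace n}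
    {A : E →L[ℝ] AmbientSpace n} (hA : ∀ i, ⟪N i, x⟫ = 0 → (innerSL ℝ (N i)).comp A = 0) :
    Filter.Tendsto (fun m => truncationDeriv N M (δ m) x A) Filter.atTop (nhds A) := by
  refine tendsto_const_nhds.congr' ?_
  have hev : ∀ i, ∀ᶠ m in Filter.atTop,
      deriv cutoffId (⟪N i, x⟫ / δ m) • ((innerSL ℝ (N i)).comp A).smulRight (M i) = 0 := by
    intro i
    by_cases hi : ⟪N i, x⟫ = 0
    · exact Filter.Eventually.of_forall fun m => by
        rw [hA i hi]; ext; simp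
    · have hpos : 0 < |⟪N i, x⟫| / 2 := by positivity
      filter_upwards [hδt.eventually_lt_const hpos] with m hm
      have h2 : 2 < |⟪N i, x⟫ / δ m| := by
        rw [abs_div, abs_of_pos (hδ0 m), lt_div_iff₀ (hδ0 m)]
        linarith
      rw [deriv_cutoffId_of_lt_abs h2]
      ext v
      simp
  filter_upwards [Filter.eventually_all.2 hev] with m hm
  rw [truncationDeriv, Finset.sum_eq_zero fun i _ => hm i, sub_zero]

theorem ae_innerSL_comp_fderiv_eq_zero (N : Fin L → AmbientSpace n)
    {K : Set (EuclideanSpace ℝ (Fin n))} (hK : IsCompact K)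
    {Z : EuclideanSpace ℝ (Fin n) → AmbientSpace n}
    (hZ : ∀ u ∈ K, HasFDerivAt Z (fderiv ℝ Z u) u) :
    ∀ᵐ u ∂(volume.restrict K), ∀ i, ⟪N i, Z u⟫ = 0 →
      (innerSL ℝ (N i)).comp (fderiv ℝ Z u) = 0 := by
  refine ae_all_iff.2 fun i => ?_
  have hd : ∀ u ∈ K, HasFDerivAt (fun v => ⟪N i, Z v⟫)
      ((innerSL ℝ (N i)).comp (fderiv ℝ Z u)) u := fun u hu =>
    (innerSL ℝ (N i)).hasFDerivAt.comp u (hZ u hu)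
  have hs : MeasurableSet (K ∩ (fun v => ⟪N i, Z v⟫) ⁻¹' {0}) :=
    (ContinuousOn.preimage_isClosed_of_isClosed
      (fun u hu => (hd u hu).continuousAt.continuousWithinAt) hK.isClosed
      isClosed_singleton).measurableSet
  have h1 := ae_fderiv_eq_zero_of_eqOn_zero volume hs
    (c := fun v => ⟪N i, Z v⟫) (fun u hu => (hd u hu.1).differentiableAt) fun u hu => hu.2
  rw [ae_restrict_iff' hs] at h1
  rw [ae_restrict_iff' hK.measurableSet]
  filter_upwards [h1] with u hu huK h0
  rw [← (hd u huK).fderiv]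
  exact hu ⟨huK, h0⟩

/-- The divergence theorem for the flux of `X` and `Y` over a compact set: at each point of the
set, either `Y` vanishes nearby outside of the set or `X` and `Y` are tangent to a common
hyperplane out of a fixed finite family. -/
theorem setIntegral_mixedDet_eq_zero {N M : Fin L → AmbientSpace n}
    (hMN : ∀ i j, ⟪M i, N j⟫ = if i = j then 1 else 0) {K : Set (EuclideanSpace ℝ (Fin n))}
    (hK : IsCompact K) {X Y : EuclideanSpace ℝ (Fin n) → AmbientSpace n}
    (hX : ∀ u ∈ K, ContDiffAt ℝ 2 X u) (hY : ∀ u ∈ K, ContDiffAt ℝ 1 Y u)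
    (h : ∀ u ∈ K, (∀ᶠ v in nhds u, v ∉ K → Y v = 0) ∨
      ∃ i, ⟪X u, N i⟫ = 0 ∧ ⟪Y u, N i⟫ = 0) :
    ∫ u in K, mixedDet (X u) (Y u) (fderiv ℝ X u) (fderiv ℝ Y u) = 0 := by
  have hN0 : ∀ i, N i ≠ 0 := fun i hi => by simpa [hi] using hMN i i
  let δ : ℕ → ℝ := fun m => 1 / ((m : ℝ) + 1)
  have hδ0 : ∀ m, 0 < δ m := fun m => by positivity
  have hδ1 : ∀ m, δ m ≤ 1 := fun m => by
    rw [div_le_one (by positivity)]; linarith [(Nat.cast_nonneg m : (0 : ℝ) ≤ m)]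
  have hδt : Filter.Tendsto δ Filter.atTop (nhds 0) := tendsto_one_div_add_atTop_nhds_zero_nat
  let T := fun m => truncation N M (δ m)
  let G : ℕ → EuclideanSpace ℝ (Fin n) → ℝ := fun m u => mixedDet (T m (X u)) (T m (Y u))
    (truncationDeriv N M (δ m) (X u) (fderiv ℝ X u))
    (truncationDeriv N M (δ m) (Y u) (fderiv ℝ Y u))
  have hXd : ∀ u ∈ K, HasFDerivAt X (fderiv ℝ X u) u := fun u hu =>
    ((hX u hu).differentiableAt (by simp)).hasFDerivAt
  have hYd : ∀ u ∈ K, HasFDerivAt Y (fderiv ℝ Y u) u := fun u hu =>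
    ((hY u hu).differentiableAt (by simp)).hasFDerivAt
  -- For fixed `δ` the truncated fields satisfy the stronger hypothesis: tangency at the point `u`
  -- becomes tangency on a neighbourhood of `u`, and vanishing of `Y` is preserved since the
  -- truncation fixes `0`.
  have hG : ∀ m, ∫ u in K, G m u = 0 := by
    intro m
    have hT : ∀ {k : WithTop ℕ∞} (_ : k ≤ ∞) {Z : EuclideanSpace ℝ (Fin n) → AmbientSpace n} {u},
        ContDiffAt ℝ k Z u → ContDiffAt ℝ k (fun v => T m (Z v)) u := fun hk _ _ hZ =>
      ((contDiff_truncation N M (δ m)).contDiffAt.of_le hk).comp _ hZ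
    have h0 := setIntegral_mixedDet_eq_zero_of_eventually hK
      (X := fun v => T m (X v)) (Y := fun v => T m (Y v))
      (fun u hu => hT (k := 2) (WithTop.coe_le_coe.2 (le_top : (2 : ℕ∞) ≤ ⊤)) (hX u hu)) (fun u hu => hT (k := 1) (mod_cast le_top) (hY u hu))
      fun u hu => by
        rcases h u hu with h | ⟨i, hXi, hYi⟩
        · left
          filter_upwards [h] with v hv hvK
          simp [T, hv hvK, truncation_zero]
        · right
          refine ⟨N i, hN0 i, ?_⟩
          have hnear : ∀ {Z : EuclideanSpace ℝ (Fin n) → AmbientSpace n}, ContinuousAt Z u →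
              ⟪Z u, N i⟫ = 0 → ∀ᶠ v in nhds u, |⟪Z v, N i⟫| < δ m := by
            intro Z hZ hZ0
            have hc : ContinuousAt (fun v => |⟪Z v, N i⟫|) u :=
              (hZ.inner continuousAt_const).abs
            exact hc.eventually_lt_const (by simpa [hZ0] using hδ0 m)
          filter_upwards [hnear (hXd u hu).continuousAt hXi, hnear (hYd u hu).continuousAt hYi]
            with v h1 h2
          exact ⟨inner_truncation_eq_zero hMN (hδ0 m) h1,
            inner_truncation_eq_zero hMN (hδ0 m) h2⟩
    rw [← h0]
    refine setIntegral_congr_fun hK.measurableSet fun u hu => ?_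
    simp only [G, T]
    rw [((hXd u hu).truncation N M (hδ0 m).ne').fderiv,
      ((hYd u hu).truncation N M (hδ0 m).ne').fderiv]
  have hXc : ContinuousOn X K := fun u hu => (hXd u hu).continuousAt.continuousWithinAt
  have hYc : ContinuousOn Y K := fun u hu => (hYd u hu).continuousAt.continuousWithinAt
  have hX'c : ContinuousOn (fderiv ℝ X) K := fun u hu =>
    ((hX u hu).fderiv_right (m := 1) (by norm_num)).continuousAt.continuousWithinAt
  have hY'c : ContinuousOn (fderiv ℝ Y) K := fun u hu =>
    ((hY u hu).fderiv_right (m := 0) (by simp)).continuousAt.continuousWithinAt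
  have hTc : ∀ m {Z : EuclideanSpace ℝ (Fin n) → AmbientSpace n}, ContinuousOn Z K →
      ContinuousOn (fun u => T m (Z u)) K := fun m Z hZ =>
    (contDiff_truncation N M (δ m)).continuous.comp_continuousOn hZ
  obtain ⟨C, hC⟩ := exists_abs_deriv_cutoffId_le
  obtain ⟨bX, hbX⟩ := hK.exists_bound_of_continuousOn hXc
  obtain ⟨bY, hbY⟩ := hK.exists_bound_of_continuousOn hYc
  obtain ⟨bX', hbX'⟩ := hK.exists_bound_of_continuousOn hX'c
  obtain ⟨bY', hbY'⟩ := hK.exists_bound_of_continuousOn hY'c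
  set c0 : ℝ := 2 * ∑ i, ‖M i‖ with hc0
  set c1 : ℝ := C * ∑ i, ‖N i‖ * ‖M i‖ with hc1
  have hc0' : 0 ≤ c0 := by positivity
  have hc1' : 0 ≤ c1 := mul_nonneg ((abs_nonneg _).trans (hC 0)) (by positivity)
  set R : ℝ := max (max (c0 + bX) (c0 + bY)) (max (c1 * bX' + bX') (c1 * bY' + bY')) with hR
  obtain ⟨D, hD⟩ := exists_abs_mixedDet_le n R
  have hTb : ∀ m x b, ‖x‖ ≤ b → ‖T m x‖ ≤ c0 + b := fun m x b hx => by
    have h1 := norm_truncation_le N M (hδ0 m).le x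
    have h2 : ‖T m x‖ ≤ ‖T m x - x‖ + ‖x‖ := norm_le_norm_sub_add _ _
    have h3 : δ m * c0 ≤ c0 := mul_le_of_le_one_left hc0' (hδ1 m)
    change ‖T m x - x‖ ≤ δ m * c0 at h1
    linarith
  have hT'b : ∀ m x (A : EuclideanSpace ℝ (Fin n) →L[ℝ] AmbientSpace n) b, ‖A‖ ≤ b →
      ‖truncationDeriv N M (δ m) x A‖ ≤ c1 * b + b := fun m x A b hA => by
    have h1 := norm_truncationDeriv_le N M hC (δ m) x A
    have h2 := norm_le_norm_sub_add (truncationDeriv N M (δ m) x A) A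
    have h3 : c1 * ‖A‖ ≤ c1 * b := by gcongr
    linarith
  have hlim : Filter.Tendsto (fun m => ∫ u in K, G m u) Filter.atTop
      (nhds (∫ u in K, mixedDet (X u) (Y u) (fderiv ℝ X u) (fderiv ℝ Y u))) := by
    -- The truncated positions and derivatives stay in a fixed ball of radius `R`, on which
    -- `mixedDet` is bounded by `D`.
    refine tendsto_integral_of_dominated_convergence (fun _ => D) (fun m => ?_) ?_ (fun m => ?_) ?_
    · exact (ContinuousOn.mixedDet (hTc m hXc) (hTc m hYc)
        (continuousOn_truncationDeriv N M _ hXc hX'c)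
        (continuousOn_truncationDeriv N M _ hYc hY'c)).aestronglyMeasurable hK.measurableSet
    · have : IsFiniteMeasure ((volume : Measure (EuclideanSpace ℝ (Fin n))).restrict K) :=
        ⟨by simpa using hK.measure_lt_top⟩
      exact integrable_const D
    · refine (ae_restrict_iff' hK.measurableSet).2 (Filter.Eventually.of_forall fun u hu => ?_)
      refine hD _ _ _ _ ?_ ?_ ?_ ?_
      · exact (hTb m _ _ (hbX u hu)).trans ((le_max_left _ _).trans (le_max_left _ _))
      · exact (hTb m _ _ (hbY u hu)).trans ((le_max_right _ _).trans (le_max_left _ _))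
      · exact (hT'b m _ _ _ (hbX' u hu)).trans ((le_max_left _ _).trans (le_max_right _ _))
      · exact (hT'b m _ _ _ (hbY' u hu)).trans ((le_max_right _ _).trans (le_max_right _ _))
    · filter_upwards [ae_innerSL_comp_fderiv_eq_zero N hK hXd,
        ae_innerSL_comp_fderiv_eq_zero N hK hYd] with u hu1 hu2
      exact tendsto_mixedDet (tendsto_truncation N M hδ0 hδt _)
        (tendsto_truncation N M hδ0 hδt _) (tendsto_truncationDeriv N M hδ0 hδt hu1)
        (tendsto_truncationDeriv N M hδ0 hδt hu2)
  simp only [hG] at hlim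
  exact tendsto_nhds_unique hlim tendsto_const_nhds

end Truncation

/-! ### An area formula for parametrizations with a linear left inverse -/

section AreaFormula

theorem LipschitzOnWith.euclideanHausdorffMeasure_image_le {X Y : Type*} [EMetricSpace X]
    [EMetricSpace Y] [MeasurableSpace X] [BorelSpace X] [MeasurableSpace Y] [BorelSpace Y]
    {C : NNReal} {f : X → Y} {s : Set X} (h : LipschitzOnWith C f s) (d : ℕ) :
    μHE[d] (f '' s) ≤ (C : ENNReal) ^ d * μHE[d] s := by
  simp_rw [Measure.euclideanHausdorffMeasure_def, Measure.smul_apply]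
  rw [mul_smul_comm]
  have h1 := h.hausdorffMeasure_image_le (d := (d : ℝ)) (by positivity)
  rw [ENNReal.rpow_natCast] at h1
  gcongr

variable {E F : Type*} [NormedAddCommGroup E] [InnerProductSpace ℝ E] [NormedAddCommGroup F] [InnerProductSpace ℝ F]
  [MeasurableSpace F] [BorelSpace F]

/-- If two maps are close up to first order,
then the areas of their images are comparable. -/
theorem euclideanHausdorffMeasure_image_le_of_norm_sub_le {f g : E → F} {π : F →L[ℝ] E}
    {s : Set E} {ε : NNReal} (hg : ∀ u ∈ s, π (g u) = u)
    (h : ∀ a ∈ s, ∀ b ∈ s, ‖(f a - f b) - (g a - g b)‖ ≤ ε * ‖a - b‖) (d : ℕ) :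
    μHE[d] (f '' s) ≤ ((1 + ε * ‖π‖₊ : NNReal) : ENNReal) ^ d * μHE[d] (g '' s) := by
  -- The first image is obtained from the second by `f ∘ π`, which on `g '' s` has Lipschitz
  -- constant `1 + ε ‖π‖`.
  have himg : f '' s = (f ∘ π) '' (g '' s) := by
    rw [image_image]
    exact image_congr fun u hu => by simp [hg u hu]
  rw [himg]
  refine LipschitzOnWith.euclideanHausdorffMeasure_image_le (LipschitzOnWith.of_dist_le_mul ?_) d
  rintro _ ⟨a, ha, rfl⟩ _ ⟨b, hb, rfl⟩
  simp only [Function.comp_apply, hg a ha, hg b hb, dist_eq_norm]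
  have h1 : ‖a - b‖ ≤ ‖π‖ * ‖g a - g b‖ := by
    conv_lhs => rw [← hg a ha, ← hg b hb, ← map_sub]
    exact π.le_opNorm _
  have h2 := norm_le_norm_sub_add (f a - f b) (g a - g b)
  have h3 := h a ha b hb
  have h4 : (ε : ℝ) * ‖a - b‖ ≤ ε * (‖π‖ * ‖g a - g b‖) := by gcongr
  push_cast [coe_nnnorm]
  linarith

variable [MeasurableSpace E] [BorelSpace E] {φ : E → F} {π : F →L[ℝ] E} {O : Set E}

theorem map_restrict_image_apply (μ : Measure F) (hπ : ∀ u ∈ O, π (φ u) = u) {A : Set E}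
    (hA : MeasurableSet A) : (μ.restrict (φ '' O)).map π A = μ (φ '' (A ∩ O)) := by
  rw [Measure.map_apply π.continuous.measurable hA,
    Measure.restrict_apply (π.continuous.measurable hA)]
  congr 1
  ext x
  constructor
  · rintro ⟨hx, u, hu, rfl⟩
    exact ⟨u, ⟨by simpa [hπ u hu] using hx, hu⟩, rfl⟩
  · rintro ⟨u, ⟨hu, huO⟩, rfl⟩
    exact ⟨by simpa [hπ u huO] using hu, u, huO, rfl⟩

variable [FiniteDimensional ℝ E]

/-- On small balls `φ` and its derivative `B` at `u` are close to first order, and `π` inverts both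
(differentiating `π ∘ φ = id` gives `π ∘ B = id`). The comparison lemma applied in both directions
therefore pins the area of the image of a ball to that of its linear image, which is `normDet` times
the volume, up to a factor tending to `1`. -/
theorem tendsto_map_restrict_closedBall_div (hO : IsOpen O) (hπ : ∀ u ∈ O, π (φ u) = u)
    {u : E} (hu : u ∈ O) (hφ : ContDiffAt ℝ 1 φ u) :
    Filter.Tendsto (fun r => ((μHE[Module.finrank ℝ E]).restrict (φ '' O)).map π
      (Metric.closedBall u r) / volume (Metric.closedBall u r)) (nhdsWithin 0 (Ioi 0))
      (nhds (ENNReal.ofReal (fderiv ℝ φ u).toLinearMap.normDet)) := by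
  set J := ENNReal.ofReal (fderiv ℝ φ u).toLinearMap.normDet with hJ
  set d := Module.finrank ℝ E with hd
  set B := fderiv ℝ φ u with hB
  have hstrict : HasStrictFDerivAt φ B u := hφ.hasStrictFDerivAt (by simp)
  have hπB : ∀ w, π (B w) = w := by
    have h1 : HasFDerivAt (fun v => π (φ v)) (π.comp B) u :=
      π.hasFDerivAt.comp u hstrict.hasFDerivAt
    have h2 : (fun v => π (φ v)) =ᶠ[nhds u] id := by
      filter_upwards [hO.mem_nhds hu] with v hv using hπ v hv
    have h3 := (h1.congr_of_eventuallyEq h2.symm).unique (hasFDerivAt_id u)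
    exact fun w => congrArg (fun L : E →L[ℝ] E => L w) h3
  let c : NNReal → ENNReal := fun ε => ((1 + ε * ‖π‖₊ : NNReal) : ENNReal) ^ d
  have hc0 : ∀ ε, c ε ≠ 0 := fun ε => pow_ne_zero _ (by
    rw [ENNReal.coe_ne_zero]; positivity)
  have hct : ∀ ε, c ε ≠ ⊤ := fun ε => ENNReal.pow_ne_top ENNReal.coe_ne_top
  have hlim : Filter.Tendsto c (nhdsWithin 0 (Ioi 0)) (nhds 1) := by
    have h1 : Continuous fun ε : NNReal => (1 + ε * ‖π‖₊) ^ d := by fun_prop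
    have h2 : Filter.Tendsto (fun ε : NNReal => ((((1 + ε * ‖π‖₊) ^ d : NNReal)) : ENNReal))
        (nhdsWithin 0 (Ioi 0)) (nhds ((1 : NNReal) : ENNReal)) :=
      ENNReal.tendsto_coe.2 (by simpa using (h1.tendsto 0).mono_left nhdsWithin_le_nhds)
    simpa [c] using h2
  have hmain : ∀ ε : NNReal, 0 < ε → ∀ᶠ r in nhdsWithin (0 : ℝ) (Ioi 0),
      ((μHE[d]).restrict (φ '' O)).map π (Metric.closedBall u r) / volume (Metric.closedBall u r)
        ≤ c ε * J ∧ J ≤ c ε * (((μHE[d]).restrict (φ '' O)).map π (Metric.closedBall u r) /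
          volume (Metric.closedBall u r)) := by
    intro ε hε
    obtain ⟨s, hs, hsapp⟩ := hstrict.approximates_deriv_on_nhds (Or.inr hε)
    obtain ⟨R, hR, hRs⟩ := Metric.mem_nhds_iff.1 (Filter.inter_mem hs (hO.mem_nhds hu))
    filter_upwards [Ioo_mem_nhdsGT hR] with r hr
    have hsub : Metric.closedBall u r ⊆ s ∩ O :=
      (Metric.closedBall_subset_ball hr.2).trans hRs
    have hv0 : volume (Metric.closedBall u r) ≠ 0 :=
      (Metric.measure_closedBall_pos volume u hr.1).ne'
    have hvt : volume (Metric.closedBall u r) ≠ ⊤ := measure_closedBall_lt_top.ne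
    have hlin : μHE[d] (B '' Metric.closedBall u r) = J * volume (Metric.closedBall u r) :=
      B.toLinearMap.euclideanHausdorffMeasure_image_eq_normDet_mul_volume _
    have hπ' : ∀ v ∈ Metric.closedBall u r, π (φ v) = v := fun v hv => hπ v (hsub hv).2
    have h1 := euclideanHausdorffMeasure_image_le_of_norm_sub_le (f := φ) (g := B) (ε := ε)
      (fun v _ => hπB v) (fun a ha b hb => by
        simpa [map_sub] using hsapp a (hsub ha).1 b (hsub hb).1) d
    have h2 := euclideanHausdorffMeasure_image_le_of_norm_sub_le (f := B) (g := φ) (ε := ε)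
      hπ' (fun a ha b hb => by
        rw [norm_sub_rev]
        simpa [map_sub] using hsapp a (hsub ha).1 b (hsub hb).1) d
    rw [map_restrict_image_apply _ hπ Metric.isClosed_closedBall.measurableSet,
      inter_eq_left.2 fun v hv => (hsub hv).2]
    rw [hlin] at h1 h2
    constructor
    · rw [ENNReal.div_le_iff hv0 hvt, mul_assoc]
      exact h1
    · rw [← mul_div_assoc, ENNReal.le_div_iff_mul_le (Or.inl hv0) (Or.inl hvt)]
      exact h2
  refine tendsto_order.2 ⟨fun a ha => ?_, fun b hb => ?_⟩
  · have h1 : Filter.Tendsto (fun ε => J / c ε) (nhdsWithin 0 (Ioi 0)) (nhds (J / 1)) :=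
      ENNReal.Tendsto.div tendsto_const_nhds (Or.inr one_ne_zero) hlim (Or.inr ENNReal.ofReal_ne_top)
    rw [div_one] at h1
    obtain ⟨ε, hε, hεpos⟩ := ((h1.eventually_const_lt ha).and self_mem_nhdsWithin).exists
    filter_upwards [hmain ε hεpos] with r hr
    refine hε.trans_le ?_
    rw [ENNReal.div_le_iff (hc0 ε) (hct ε), mul_comm]
    exact hr.2
  · have h1 : Filter.Tendsto (fun ε => c ε * J) (nhdsWithin 0 (Ioi 0)) (nhds (1 * J)) :=
      ENNReal.Tendsto.mul_const hlim (Or.inl one_ne_zero)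
    rw [one_mul] at h1
    obtain ⟨ε, hε, hεpos⟩ := ((h1.eventually_lt_const hb).and self_mem_nhdsWithin).exists
    filter_upwards [hmain ε hεpos] with r hr
    exact hr.1.trans_lt hε

/-- The area formula for a Lipschitz `C¹` parametrization that is inverted by a linear map. -/
theorem map_restrict_image_eq_withDensity (hO : IsOpen O) (hOfin : volume O ≠ ⊤)
    (hπ : ∀ u ∈ O, π (φ u) = u) (hφ : ∀ u ∈ O, ContDiffAt ℝ 1 φ u) {C : NNReal}
    (hC : LipschitzOnWith C φ O) :
    ((μHE[Module.finrank ℝ E]).restrict (φ '' O)).map π =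
      (volume.restrict O).withDensity
        fun u => ENNReal.ofReal (fderiv ℝ φ u).toLinearMap.normDet := by
  set d := Module.finrank ℝ E with hd
  set m := ((μHE[d]).restrict (φ '' O)).map π with hm
  have hle : ∀ A, MeasurableSet A → m A ≤ (C : ENNReal) ^ d * volume (A ∩ O) := by
    intro A hA
    rw [hm, map_restrict_image_apply _ hπ hA]
    refine ((hC.mono inter_subset_right).euclideanHausdorffMeasure_image_le d).trans ?_
    rw [hd, InnerProductSpace.euclideanHausdorffMeasure_eq_volume]
  have hfin : IsFiniteMeasure m := ⟨by
    refine (hle _ MeasurableSet.univ).trans_lt ?_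
    rw [univ_inter]
    exact ENNReal.mul_lt_top (ENNReal.pow_lt_top ENNReal.coe_lt_top) (lt_top_iff_ne_top.2 hOfin)⟩
  have hac : m ≪ volume.restrict O := by
    refine Measure.AbsolutelyContinuous.mk fun A hA h0 => ?_
    rw [Measure.restrict_apply hA] at h0
    simpa [h0] using hle A hA
  have hac' : m ≪ volume := hac.trans Measure.restrict_le_self.absolutelyContinuous
  have hrn : ∀ᵐ u ∂(volume : Measure E), u ∈ O →
      m.rnDeriv volume u = ENNReal.ofReal (fderiv ℝ φ u).toLinearMap.normDet := by
    -- Almost everywhere the Radon–Nikodym density is the limit of the ratios on balls, which has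
    -- just been identified with the Jacobian.
    filter_upwards [Besicovitch.ae_tendsto_rnDeriv m volume] with u hu huO
    exact tendsto_nhds_unique hu (tendsto_map_restrict_closedBall_div hO hπ huO (hφ u huO))
  have hOm := hO.measurableSet
  have hres : m.restrict O = m := by
    refine Measure.restrict_eq_self_of_ae_mem ?_
    exact hac.ae_le (ae_restrict_mem hOm)
  rw [← hres]
  conv_lhs => rw [← Measure.withDensity_rnDeriv_eq m volume hac']
  rw [restrict_withDensity hOm]
  exact withDensity_congr_ae ((ae_restrict_iff' hOm).2 hrn)

/-- Integration over a compact part of a parametrized hypersurface. -/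
theorem integrableOn_image_and_setIntegral_image (hO : IsOpen O) (hOfin : volume O ≠ ⊤)
    (hπ : ∀ u ∈ O, π (φ u) = u) (hφ : ∀ u ∈ O, ContDiffAt ℝ 1 φ u) {C : NNReal}
    (hC : LipschitzOnWith C φ O) {j : E → ℝ} (hj : ContinuousOn j O)
    (hjφ : ∀ u ∈ O, j u = (fderiv ℝ φ u).toLinearMap.normDet) {K : Set E} (hK : IsCompact K)
    (hKO : K ⊆ O) {g : F → ℝ} (hg : ContinuousOn (fun u => g (φ u)) K) :
    IntegrableOn g (φ '' K) μHE[Module.finrank ℝ E] ∧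
      ∫ x in φ '' K, g x ∂μHE[Module.finrank ℝ E] = ∫ u in K, j u * g (φ u) := by
  set d := Module.finrank ℝ E with hd
  have hφc : ContinuousOn φ K := fun u hu => (hφ u (hKO hu)).continuousAt.continuousWithinAt
  have hKφ : MeasurableSet (φ '' K) := (hK.image_of_continuousOn hφc).measurableSet
  -- Because `π` inverts `φ`, restricting the surface measure to the image of `K` amounts to
  -- restricting its pushforward under `π` to `K`.
  have hpre : φ '' K = φ '' O ∩ π ⁻¹' K := by
    ext x
    constructor
    · rintro ⟨u, hu, rfl⟩
      exact ⟨⟨u, hKO hu, rfl⟩, by simpa [hπ u (hKO hu)] using hu⟩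
    · rintro ⟨⟨u, hu, rfl⟩, hx⟩
      exact ⟨u, by simpa [hπ u hu] using hx, rfl⟩
  have hπm := π.continuous.measurable
  have hmap : ((μHE[d]).restrict (φ '' K)).map π =
      (volume.restrict K).withDensity fun u => ENNReal.ofReal (j u) := by
    rw [hpre, inter_comm, ← Measure.restrict_restrict (hπm hK.measurableSet),
      ← Measure.restrict_map hπm hK.measurableSet,
      map_restrict_image_eq_withDensity hO hOfin hπ hφ hC, restrict_withDensity hK.measurableSet,
      Measure.restrict_restrict hK.measurableSet, inter_eq_left.2 hKO]
    refine withDensity_congr_ae ((ae_restrict_iff' hK.measurableSet).2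
      (Filter.Eventually.of_forall fun u hu => ?_))
    simp only [hjφ u (hKO hu)]
  have hjK : ContinuousOn j K := hj.mono hKO
  have hjm : AEMeasurable (fun u => ENNReal.ofReal (j u)) (volume.restrict K) :=
    (hjK.aemeasurable hK.measurableSet).ennreal_ofReal
  have hgm : AEStronglyMeasurable (fun u => g (φ u)) (((μHE[d]).restrict (φ '' K)).map π) := by
    rw [hmap]
    exact (hg.aestronglyMeasurable hK.measurableSet).mono_ac (withDensity_absolutelyContinuous _ _)
  have hgeq : (fun x => g (φ (π x))) =ᵐ[(μHE[d]).restrict (φ '' K)] g := by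
    refine (ae_restrict_iff' hKφ).2 (Filter.Eventually.of_forall ?_)
    rintro _ ⟨u, hu, rfl⟩
    simp [hπ u (hKO hu)]
  constructor
  · have hfin : IsFiniteMeasure ((μHE[d]).restrict (φ '' K)) := ⟨by
      rw [Measure.restrict_apply_univ]
      refine ((hC.mono hKO).euclideanHausdorffMeasure_image_le d).trans_lt ?_
      rw [hd, InnerProductSpace.euclideanHausdorffMeasure_eq_volume]
      exact ENNReal.mul_lt_top (ENNReal.pow_lt_top ENNReal.coe_lt_top) hK.measure_lt_top⟩
    obtain ⟨b, hb⟩ := hK.exists_bound_of_continuousOn hg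
    refine Integrable.of_bound ((hgm.comp_measurable hπm).congr hgeq) b
      ((ae_restrict_iff' hKφ).2 (Filter.Eventually.of_forall ?_))
    rintro _ ⟨u, hu, rfl⟩
    exact hb u hu
  · rw [← integral_congr_ae hgeq, ← integral_map hπm.aemeasurable hgm, hmap,
      integral_withDensity_eq_integral_toReal_smul₀ hjm (by simp)]
    refine setIntegral_congr_fun hK.measurableSet fun u hu => ?_
    have hj0 : 0 ≤ j u := by rw [hjφ u (hKO hu)]; exact LinearMap.normDet_nonneg _
    simp [ENNReal.toReal_ofReal hj0]

end AreaFormula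

/-! ### Graph charts of regular zero sets -/

section Charts

variable {n : ℕ}

theorem detForm_sq (v : Fin (n + 1) → AmbientSpace n) :
    detForm n v ^ 2 = (Matrix.gram ℝ v).det := by
  have h : Matrix.gram ℝ v =
      (Matrix.of fun i j => v j i).transpose * Matrix.of fun i j => v j i := by
    ext j k
    rw [Matrix.gram_apply, PiLp.inner_apply, Matrix.mul_apply]
    refine Finset.sum_congr rfl fun i _ => ?_
    simp [mul_comm]
  rw [h, Matrix.det_mul, Matrix.det_transpose, detForm_apply, sq]

/-- The Gram matrix of `(a, v₁, …, vₙ)` splits off the diagonal entry `‖a‖² = 1`. -/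
theorem detCons_sq_of_inner_eq_zero {a : AmbientSpace n} {v : Fin n → AmbientSpace n}
    (ha : ‖a‖ = 1) (h : ∀ k, ⟪a, v k⟫ = 0) :
    detCons a v ^ 2 = (Matrix.gram ℝ v).det := by
  rw [detCons, detForm_sq, Matrix.det_succ_row_zero, Fin.sum_univ_succ, Finset.sum_eq_zero]
  · have h1 : (Matrix.gram ℝ (Fin.cons a v : Fin (n + 1) → AmbientSpace n)).submatrix Fin.succ
        (Fin.succAbove 0) = Matrix.gram ℝ v := by
      ext i j
      simp [Matrix.gram_apply]
    rw [h1]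
    simp [Matrix.gram_apply, ha]
  · intro k _
    simp [Matrix.gram_apply, h k]

/-- The volume factor of a linear parametrization of a hyperplane with unit normal `ν`. -/
theorem normDet_eq_abs_detCons {B : EuclideanSpace ℝ (Fin n) →L[ℝ] AmbientSpace n}
    {ν : AmbientSpace n} (hν : ‖ν‖ = 1) (h : ∀ w, ⟪ν, B w⟫ = 0) :
    B.toLinearMap.normDet = |detCons ν (fun k => B (EuclideanSpace.single k 1))| := by
  have h1 := B.toLinearMap.normDet_sq_eq_det_gram (EuclideanSpace.basisFun (Fin n) ℝ)
  have h2 := detCons_sq_of_inner_eq_zero hν fun k => h (EuclideanSpace.single k 1)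
  have h3 : B.toLinearMap.normDet ^ 2 =
      detCons ν (fun k => B (EuclideanSpace.single k 1)) ^ 2 := by
    rw [h2]
    simpa using h1
  rw [← abs_of_nonneg B.toLinearMap.normDet_nonneg]
  exact (sq_eq_sq_iff_abs_eq_abs _ _).1 h3

/-- A parametrization of the part in the open set `V` of the set `Z`, inverted by a linear map and
with continuous unit normal `ν`. -/
structure HypersurfaceChart (Z : Set (AmbientSpace n)) (ν : AmbientSpace n → AmbientSpace n) where
  /-- the parametrization -/
  φ : EuclideanSpace ℝ (Fin n) → AmbientSpace n
  /-- the linear inverse of the parametrization -/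
  π : AmbientSpace n →L[ℝ] EuclideanSpace ℝ (Fin n)
  /-- the parameter domain -/
  O : Set (EuclideanSpace ℝ (Fin n))
  /-- the open set in which the hypersurface is parametrized -/
  V : Set (AmbientSpace n)
  /-- a Lipschitz constant -/
  C : NNReal
  /-- the orientation -/
  σ : ℝ
  isOpen_O : IsOpen O
  isOpen_V : IsOpen V
  volume_ne_top : volume O ≠ ⊤
  lipschitzOnWith : LipschitzOnWith C φ O
  contDiffAt : ∀ u ∈ O, ContDiffAt ℝ ∞ φ u
  π_φ : ∀ u ∈ O, π (φ u) = u
  φ_mem : ∀ u ∈ O, φ u ∈ Z ∩ V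
  π_mem : ∀ x ∈ Z ∩ V, π x ∈ O
  φ_π : ∀ x ∈ Z ∩ V, φ (π x) = x
  norm_normal : ∀ u ∈ O, ‖ν (φ u)‖ = 1
  inner_normal : ∀ u ∈ O, ∀ w, ⟪ν (φ u), fderiv ℝ φ u w⟫ = 0
  continuousOn_normal : ContinuousOn (fun u => ν (φ u)) O
  normDet_eq : ∀ u ∈ O, (fderiv ℝ φ u).toLinearMap.normDet =
    σ * detCons (ν (φ u)) (fun k => fderiv ℝ φ u (EuclideanSpace.single k 1))
  det_ne_zero : ∀ u ∈ O,
    detCons (ν (φ u)) (fun k => fderiv ℝ φ u (EuclideanSpace.single k 1)) ≠ 0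

theorem inner_gradient_eq_fderiv {f : AmbientSpace n → ℝ} (x w : AmbientSpace n) :
    ⟪∇ f x, w⟫ = fderiv ℝ f x w := by
  rw [gradient, InnerProductSpace.toDual_symm_apply]

theorem contDiffOn_gradient {f : AmbientSpace n → ℝ} {U : Set (AmbientSpace n)} (hU : IsOpen U)
    (hf : ContDiffOn ℝ ∞ f U) : ContDiffOn ℝ ∞ (∇ f) U := by
  have h : ContDiffOn ℝ ∞ (fderiv ℝ f) U := hf.fderiv_of_isOpen hU (by simp)
  exact (InnerProductSpace.toDual ℝ (AmbientSpace n)).symm.contDiff.comp_contDiffOn h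

/-- The regular zero set of a smooth function has a graph parametrization near each point. -/
theorem exists_graph_parametrization {f : AmbientSpace n → ℝ} {U : Set (AmbientSpace n)}
    (hU : IsOpen U) (hf : ContDiffOn ℝ ∞ f U) {x₀ : AmbientSpace n} (hx₀ : x₀ ∈ U)
    (hg : ∇ f x₀ ≠ 0) :
    ∃ (φ : EuclideanSpace ℝ (Fin n) → AmbientSpace n)
      (π : AmbientSpace n →L[ℝ] EuclideanSpace ℝ (Fin n)) (O : Set (EuclideanSpace ℝ (Fin n)))
      (V : Set (AmbientSpace n)), IsOpen O ∧ IsOpen V ∧ x₀ ∈ V ∧ V ⊆ U ∧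
      (∀ u ∈ O, ContDiffAt ℝ ∞ φ u) ∧ (∀ u ∈ O, π (φ u) = u) ∧
      (∀ u ∈ O, φ u ∈ {x | f x = 0} ∩ V) ∧
      ∀ x ∈ {x | f x = 0} ∩ V, π x ∈ O ∧ φ (π x) = x := by
  have : Fact (Module.finrank ℝ (AmbientSpace n) = n + 1) := ⟨by simp⟩
  let ι := (OrthonormalBasis.fromOrthogonalSpanSingleton (𝕜 := ℝ) n hg).repr
  let π : AmbientSpace n →L[ℝ] EuclideanSpace ℝ (Fin n) :=
    (ι : _ →L[ℝ] EuclideanSpace ℝ (Fin n)) ∘L (ℝ ∙ ∇ f x₀)ᗮ.orthogonalProjectionOnto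
  -- Here `π` is the orthogonal projection along `∇f(x₀)`, so the kernel of `π` is the line on which
  -- `df` is nonzero; hence `Ψ = (f, π)` is a local diffeomorphism at `x₀`, and its inverse on the
  -- slice `f = 0` is the graph parametrization.
  let Ψ : AmbientSpace n → ℝ × EuclideanSpace ℝ (Fin n) := fun x => (f x, π x)
  have hΨ : ContDiffOn ℝ ∞ Ψ U := hf.prodMk π.contDiff.contDiffOn
  have hΨat : ∀ x ∈ U, ContDiffAt ℝ ∞ Ψ x := fun x hx => hΨ.contDiffAt (hU.mem_nhds hx)
  have hΨ' : HasFDerivAt Ψ ((fderiv ℝ f x₀).prod π) x₀ :=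
    ((hf.contDiffAt (hU.mem_nhds hx₀)).differentiableAt (by simp)).hasFDerivAt.prodMk
      π.hasFDerivAt
  have hinj : Function.Injective ((fderiv ℝ f x₀).prod π).toLinearMap := by
    rw [← LinearMap.ker_eq_bot, LinearMap.ker_eq_bot']
    intro w hw
    have hw1 : fderiv ℝ f x₀ w = 0 := congrArg Prod.fst hw
    have hw2 : π w = 0 := congrArg Prod.snd hw
    have hw3 : (ℝ ∙ ∇ f x₀)ᗮ.orthogonalProjectionOnto w = 0 := by
      have h : ι ((ℝ ∙ ∇ f x₀)ᗮ.orthogonalProjectionOnto w) = 0 := hw2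
      simpa using h
    rw [Submodule.orthogonalProjectionOnto_eq_zero_iff, Submodule.orthogonal_orthogonal,
      Submodule.mem_span_singleton] at hw3
    obtain ⟨c, rfl⟩ := hw3
    rw [← inner_gradient_eq_fderiv, real_inner_smul_right, mul_eq_zero, inner_self_eq_zero] at hw1
    rcases hw1 with h | h
    · rw [h, zero_smul]
    · exact absurd h hg
  let Λ : AmbientSpace n ≃L[ℝ] ℝ × EuclideanSpace ℝ (Fin n) :=
    (LinearMap.linearEquivOfInjective ((fderiv ℝ f x₀).prod π).toLinearMap hinj
      (by simp [add_comm])).toContinuousLinearEquiv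
  have hΛ : HasFDerivAt Ψ (Λ : AmbientSpace n →L[ℝ] ℝ × EuclideanSpace ℝ (Fin n)) x₀ :=
    hΨ'.congr_fderiv (by ext <;> rfl)
  let e := (hΨat x₀ hx₀).toOpenPartialHomeomorph Ψ hΛ (by simp)
  have heΨ : ∀ x, e x = Ψ x := fun x => rfl
  -- Restricting to points where the derivative of `Ψ` is invertible makes the local inverse smooth
  -- throughout the chart, and not only at the image of `x₀`.
  let G : Set (AmbientSpace n) := U ∩ fderiv ℝ Ψ ⁻¹' range
    ((↑) : (AmbientSpace n ≃L[ℝ] ℝ × EuclideanSpace ℝ (Fin n)) → _ →L[ℝ] _)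
  have hG : IsOpen G := (hΨ.continuousOn_fderiv_of_isOpen hU (by simp)).isOpen_inter_preimage hU
    ContinuousLinearEquiv.isOpen
  let V := e.source ∩ G
  have hV : IsOpen V := e.open_source.inter hG
  let O : Set (EuclideanSpace ℝ (Fin n)) :=
    (fun u => ((0 : ℝ), u)) ⁻¹' (e.target ∩ e.symm ⁻¹' V)
  have hO : IsOpen O := (e.isOpen_inter_preimage_symm hV).preimage (by fun_prop)
  refine ⟨fun u => e.symm (0, u), π, O, V, hO, hV,
    ⟨(hΨat x₀ hx₀).mem_toOpenPartialHomeomorph_source hΛ (by simp), hx₀, Λ, hΛ.fderiv.symm⟩,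
    fun x hx => hx.2.1, fun u hu => ?_, fun u hu => ?_, fun u hu => ?_, fun x hx => ?_⟩
  · obtain ⟨Λ', hΛ'⟩ := hu.2.2.2
    have h1 : HasFDerivAt e (Λ' : AmbientSpace n →L[ℝ] _) (e.symm (0, u)) := by
      rw [hΛ']
      exact ((hΨat _ hu.2.2.1).differentiableAt (by simp)).hasFDerivAt
    have h2 := e.contDiffAt_symm hu.1 h1 (hΨat _ hu.2.2.1)
    exact h2.comp u (contDiffAt_const.prodMk contDiffAt_id)
  · exact congrArg Prod.snd (e.right_inv hu.1)
  · exact ⟨congrArg Prod.fst (e.right_inv hu.1), hu.2⟩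
  · have h1 : ((0 : ℝ), π x) = e x := by
      rw [heΨ]
      exact Prod.ext hx.1.symm rfl
    have h2 : e.symm (0, π x) = x := by rw [h1, e.left_inv hx.2.1]
    refine ⟨⟨?_, ?_⟩, h2⟩
    · change ((0 : ℝ), π x) ∈ e.target
      rw [h1]
      exact e.map_source hx.2.1
    · change e.symm (0, π x) ∈ V
      rw [h2]
      exact hx.2

/-- The graph parametrization is restricted to a ball on which it is Lipschitz and on which the
determinant of normal and frame, nonzero because `π ∘ dφ = id`, keeps the sign it has at the centre.
That sign is the orientation `σ`. -/
theorem exists_hypersurfaceChart {f : AmbientSpace n → ℝ} {U : Set (AmbientSpace n)}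
    (hU : IsOpen U) (hf : ContDiffOn ℝ ∞ f U) {x₀ : AmbientSpace n} (hx₀ : x₀ ∈ U)
    (hfx₀ : f x₀ = 0) (hg : ∀ x ∈ U, ∇ f x ≠ 0) :
    ∃ c : HypersurfaceChart {x | f x = 0} (fun x => ‖∇ f x‖⁻¹ • ∇ f x), x₀ ∈ c.V ∧ c.V ⊆ U := by
  obtain ⟨φ, π, O, V, hO, hV, hx₀V, hVU, hφ, hπφ, hφV, hπV⟩ :=
    exists_graph_parametrization hU hf hx₀ (hg x₀ hx₀)
  set ν : AmbientSpace n → AmbientSpace n := fun x => ‖∇ f x‖⁻¹ • ∇ f x with hν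
  have hνn : ∀ u ∈ O, ‖ν (φ u)‖ = 1 := fun u hu => by
    have h := hg _ (hVU (hφV u hu).2)
    rw [hν, norm_smul, norm_inv, norm_norm, inv_mul_cancel₀ (norm_ne_zero_iff.2 h)]
  have hνi : ∀ u ∈ O, ∀ w, ⟪ν (φ u), fderiv ℝ φ u w⟫ = 0 := by
    intro u hu w
    have h1 : HasFDerivAt (fun v => f (φ v)) ((fderiv ℝ f (φ u)).comp (fderiv ℝ φ u)) u :=
      ((hf.contDiffAt (hU.mem_nhds (hVU (hφV u hu).2))).differentiableAt
        (by simp)).hasFDerivAt.comp u ((hφ u hu).differentiableAt (by simp)).hasFDerivAt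
    have h2 : (fun v => f (φ v)) =ᶠ[nhds u] fun _ => (0 : ℝ) := by
      filter_upwards [hO.mem_nhds hu] with v hv using (hφV v hv).1
    have h3 := (h1.congr_of_eventuallyEq h2.symm).unique (hasFDerivAt_const (0 : ℝ) u)
    have h4 : fderiv ℝ f (φ u) (fderiv ℝ φ u w) = 0 := congrArg (fun L => L w) h3
    rw [hν, real_inner_smul_left, inner_gradient_eq_fderiv, h4, mul_zero]
  have hνc : ContinuousOn (fun u => ν (φ u)) O := by
    have h1 : ContinuousOn ν U := by
      have h := (contDiffOn_gradient hU hf).continuousOn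
      exact (h.norm.inv₀ fun x hx => norm_ne_zero_iff.2 (hg x hx)).smul h
    exact h1.comp (fun u hu => (hφ u hu).continuousAt.continuousWithinAt)
      fun u hu => hVU (hφV u hu).2
  let D : EuclideanSpace ℝ (Fin n) → ℝ := fun u =>
    detCons (ν (φ u)) (fun k => fderiv ℝ φ u (EuclideanSpace.single k 1))
  have hD : ∀ u ∈ O, (fderiv ℝ φ u).toLinearMap.normDet = |D u| := fun u hu =>
    normDet_eq_abs_detCons (hνn u hu) (hνi u hu)
  have hD0 : ∀ u ∈ O, D u ≠ 0 := by
    intro u hu h0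
    have h1 := hD u hu
    rw [h0, abs_zero, LinearMap.normDet_eq_zero_iff_ker_ne_bot] at h1
    refine h1 (LinearMap.ker_eq_bot'.2 fun w hw => ?_)
    have h2 : HasFDerivAt (fun v => π (φ v)) (π.comp (fderiv ℝ φ u)) u :=
      π.hasFDerivAt.comp u ((hφ u hu).differentiableAt (by simp)).hasFDerivAt
    have h3 : (fun v => π (φ v)) =ᶠ[nhds u] id := by
      filter_upwards [hO.mem_nhds hu] with v hv using hπφ v hv
    have h4 := (h2.congr_of_eventuallyEq h3.symm).unique (hasFDerivAt_id u)
    have h5 : π (fderiv ℝ φ u w) = w := congrArg (fun L : _ →L[ℝ] _ => L w) h4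
    have h6 : fderiv ℝ φ u w = 0 := hw
    rw [← h5, h6, map_zero]
  have hφ'c : ContinuousOn (fderiv ℝ φ) O := fun u hu =>
    ((hφ u hu).fderiv_right (m := 0) (by simp)).continuousAt.continuousWithinAt
  have hDc : ContinuousOn D O :=
    ContinuousOn.detCons hνc (continuousOn_pi.2 fun k => hφ'c.clm_apply continuousOn_const)
  set u₀ := π x₀ with hu₀
  have hu₀O : u₀ ∈ O := (hπV x₀ ⟨hfx₀, hx₀V⟩).1
  obtain ⟨C, s, hs, hC⟩ := ((hφ u₀ hu₀O).of_le (by simp)).exists_lipschitzOnWith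
  have hsign : ∀ᶠ u in nhds u₀, 0 < D u₀ * D u := by
    have h1 : ContinuousAt (fun u => D u₀ * D u) u₀ :=
      continuousAt_const.mul (hDc.continuousAt (hO.mem_nhds hu₀O))
    exact h1.eventually_const_lt (mul_self_pos.2 (hD0 u₀ hu₀O))
  obtain ⟨r, hr, hball⟩ := Metric.mem_nhds_iff.1
    (Filter.inter_mem (Filter.inter_mem hs (hO.mem_nhds hu₀O)) hsign)
  have hbO : Metric.ball u₀ r ⊆ O := fun u hu => (hball hu).1.2
  refine ⟨⟨φ, π, Metric.ball u₀ r, V ∩ π ⁻¹' Metric.ball u₀ r, C, SignType.sign (D u₀),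
    Metric.isOpen_ball, hV.inter (Metric.isOpen_ball.preimage π.continuous),
    measure_ball_lt_top.ne, hC.mono fun u hu => (hball hu).1.1, fun u hu => hφ u (hbO hu),
    fun u hu => hπφ u (hbO hu), fun u hu => ⟨(hφV u (hbO hu)).1, (hφV u (hbO hu)).2, ?_⟩,
    fun x hx => hx.2.2, fun x hx => (hπV x ⟨hx.1, hx.2.1⟩).2, fun u hu => hνn u (hbO hu),
    fun u hu => hνi u (hbO hu), hνc.mono hbO, fun u hu => ?_,
    fun u hu => hD0 u (hbO hu)⟩,
    ⟨hx₀V, Metric.mem_ball_self hr⟩, fun x hx => hVU hx.1⟩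
  · rwa [mem_preimage, hπφ u (hbO hu)]
  · rw [hD u (hbO hu)]
    have h1 : 0 < D u₀ * D u := (hball hu).2
    change |D u| = SignType.sign (D u₀) * D u
    rcases pos_and_pos_or_neg_and_neg_of_mul_pos h1 with ⟨h2, h3⟩ | ⟨h2, h3⟩
    · simp [h2, abs_of_pos h3]
    · simp [h2, abs_of_neg h3]

end Charts

/-! ### The divergence theorem on a capillary hypersurface -/

section Surface

variable {n L : ℕ}

theorem exists_tangentFrame (ν : AmbientSpace n) :
    ∃ ι : EuclideanSpace ℝ (Fin n) →ₗᵢ[ℝ] AmbientSpace n, ∀ w, ⟪ν, ι w⟫ = 0 := by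
  have : Fact (Module.finrank ℝ (AmbientSpace n) = n + 1) := ⟨by simp⟩
  have h : ∀ a : AmbientSpace n, a ≠ 0 →
      ∃ ι : EuclideanSpace ℝ (Fin n) →ₗᵢ[ℝ] AmbientSpace n, ∀ w, ⟪a, ι w⟫ = 0 := by
    intro a ha
    let e := (OrthonormalBasis.fromOrthogonalSpanSingleton (𝕜 := ℝ) n ha).repr
    refine ⟨(ℝ ∙ a)ᗮ.subtypeₗᵢ.comp e.symm.toLinearIsometry, fun w => ?_⟩
    exact Submodule.mem_orthogonal_singleton_iff_inner_right.1 (e.symm w).2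
  -- For `ν = 0` the orthogonality is void and any isometric embedding serves; this makes the frame
  -- total in `ν`.
  by_cases hν : ν = 0
  · obtain ⟨a, ha⟩ := exists_ne (0 : AmbientSpace n)
    obtain ⟨ι, -⟩ := h a ha
    exact ⟨ι, fun w => by simp [hν]⟩
  · exact h ν hν

/-- An isometric parametrization of the orthogonal complement of a vector. -/
noncomputable def tangentFrame (ν : AmbientSpace n) :
    EuclideanSpace ℝ (Fin n) →ₗᵢ[ℝ] AmbientSpace n :=
  Classical.choose (exists_tangentFrame ν)

theorem inner_tangentFrame (ν : AmbientSpace n) (w : EuclideanSpace ℝ (Fin n)) :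
    ⟪ν, tangentFrame ν w⟫ = 0 :=
  Classical.choose_spec (exists_tangentFrame ν) w

theorem exists_apply_eq_of_inner_eq_zero {ν : AmbientSpace n} (hν : ‖ν‖ = 1)
    {B : EuclideanSpace ℝ (Fin n) →ₗ[ℝ] AmbientSpace n} (hB : Function.Injective B)
    (hBν : ∀ v, ⟪ν, B v⟫ = 0) {w : AmbientSpace n} (hw : ⟪ν, w⟫ = 0) : ∃ v, B v = w := by
  have : Fact (Module.finrank ℝ (AmbientSpace n) = n + 1) := ⟨by simp⟩
  have hν0 : ν ≠ 0 := fun h => by simp [h] at hν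
  have h1 : LinearMap.range B ≤ (ℝ ∙ ν)ᗮ := by
    rintro _ ⟨v, rfl⟩
    exact Submodule.mem_orthogonal_singleton_iff_inner_right.2 (hBν v)
  have h2 : LinearMap.range B = (ℝ ∙ ν)ᗮ := by
    refine Submodule.eq_of_le_of_finrank_eq h1 ?_
    rw [LinearMap.finrank_range_of_inj hB,
      Submodule.finrank_orthogonal_span_singleton (n := n) hν0, finrank_euclideanSpace_fin]
  have h3 : w ∈ LinearMap.range B := by
    rw [h2]
    exact Submodule.mem_orthogonal_singleton_iff_inner_right.2 hw
  exact h3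

theorem exists_tangentFrame_eq {ν : AmbientSpace n} (hν : ‖ν‖ = 1) {w : AmbientSpace n}
    (hw : ⟪ν, w⟫ = 0) : ∃ v, tangentFrame ν v = w :=
  exists_apply_eq_of_inner_eq_zero hν (B := (tangentFrame ν).toLinearMap)
    (tangentFrame ν).injective (inner_tangentFrame ν) hw

/-- The orientation `±1` of the frame `tangentFrame ν`. -/
noncomputable def frameSign (ν : AmbientSpace n) : ℝ :=
  detCons ν (fun k => tangentFrame ν (EuclideanSpace.single k 1))

theorem frameSign_mul_self {ν : AmbientSpace n} (hν : ‖ν‖ = 1) :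
    frameSign ν * frameSign ν = 1 := by
  have h := normDet_eq_abs_detCons (B := (tangentFrame ν).toContinuousLinearMap) hν
    (inner_tangentFrame ν)
  have h2 : (tangentFrame ν).toContinuousLinearMap.toLinearMap.normDet = 1 :=
    (tangentFrame ν).normDet_eq_one
  rw [h2] at h
  rw [← abs_mul_abs_self (frameSign ν)]
  change |detCons ν _| * |detCons ν _| = 1
  simp only [LinearIsometry.coe_toContinuousLinearMap] at h
  rw [← h, one_mul]

/-- The density with respect to area of the form
`-n det (y; dx, …, dx) + ∑ₖ det (x; dx, …, dy, …, dx)` on the hyperplane orthogonal to `ν`, where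
`A = dx` and `B = dy`. -/
noncomputable def surfaceMixedDet (ν x y : AmbientSpace n)
    (A B : AmbientSpace n →L[ℝ] AmbientSpace n) : ℝ :=
  frameSign ν * mixedDet x y (A ∘L (tangentFrame ν).toContinuousLinearMap)
    (B ∘L (tangentFrame ν).toContinuousLinearMap)

/-- The frame `B₀` factors through `tangentFrame ν` by a linear map `C`, and both `mixedDet` and the
volume determinant scale by `det C`. So the quotient does not depend on the frame, and `frameSign`
squares to `1`. -/
theorem mixedDet_eq_detCons_mul_surfaceMixedDet {ν : AmbientSpace n} (hν : ‖ν‖ = 1)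
    {B₀ : EuclideanSpace ℝ (Fin n) →L[ℝ] AmbientSpace n} (hB₀ : ∀ w, ⟪ν, B₀ w⟫ = 0)
    (x y : AmbientSpace n) (A B : AmbientSpace n →L[ℝ] AmbientSpace n) :
    mixedDet x y (A ∘L B₀) (B ∘L B₀) =
      detCons ν (fun k => B₀ (EuclideanSpace.single k 1)) * surfaceMixedDet ν x y A B := by
  set ι := (tangentFrame ν).toContinuousLinearMap with hι
  let C : EuclideanSpace ℝ (Fin n) →L[ℝ] EuclideanSpace ℝ (Fin n) :=
    (ContinuousLinearMap.adjoint ι) ∘L B₀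
  have hadj : ∀ v, ContinuousLinearMap.adjoint ι (ι v) = v := by
    intro v
    refine ext_inner_right ℝ fun w => ?_
    rw [ContinuousLinearMap.adjoint_inner_left]
    exact (tangentFrame ν).inner_map_map v w
  have hC : B₀ = ι ∘L C := by
    ext1 w
    obtain ⟨v, hv⟩ := exists_tangentFrame_eq hν (hB₀ w)
    have hv' : ι v = B₀ w := hv
    simp only [C, ContinuousLinearMap.comp_apply, ← hv', hadj]
  have h1 : detCons ν (fun k => B₀ (EuclideanSpace.single k 1)) =
      LinearMap.det C.toLinearMap * frameSign ν := by
    rw [hC]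
    exact detCons_comp ν ι.toLinearMap C.toLinearMap
  rw [h1, surfaceMixedDet, mul_assoc, ← mul_assoc (frameSign ν), frameSign_mul_self hν, one_mul,
    ← mixedDet_comp, hC]
  rfl

theorem surfaceMixedDet_zero (ν x : AmbientSpace n) (A : AmbientSpace n →L[ℝ] AmbientSpace n) :
    surfaceMixedDet ν x 0 A 0 = 0 := by
  rw [surfaceMixedDet, ContinuousLinearMap.zero_comp, mixedDet_zero, mul_zero]

theorem surfaceMixedDet_sum {ι : Type*} (s : Finset ι) (ν x : AmbientSpace n)
    (y : ι → AmbientSpace n) (A : AmbientSpace n →L[ℝ] AmbientSpace n)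
    (B : ι → AmbientSpace n →L[ℝ] AmbientSpace n) :
    surfaceMixedDet ν x (∑ i ∈ s, y i) A (∑ i ∈ s, B i) =
      ∑ i ∈ s, surfaceMixedDet ν x (y i) A (B i) := by
  simp only [surfaceMixedDet]
  rw [← Finset.mul_sum, ← mixedDet_sum]
  congr 2
  ext
  simp

/-- The columns of the inverse Gram matrix give the dual frame within the span of the normals. -/
theorem Wedge.exists_dual (W : Wedge n L) :
    ∃ M : Fin L → AmbientSpace n, ∀ i j, ⟪M i, W.N j⟫ = if i = j then 1 else 0 := by
  refine ⟨fun i => ∑ j, ((Matrix.gram ℝ W.N)⁻¹.mulVec (Pi.single i 1)) j • W.N j, fun i j => ?_⟩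
  rw [W.inner_sum_eq_gram_mulVec, Matrix.mulVec_mulVec, Matrix.mul_nonsing_inv _ W.isUnit_det_gram,
    Matrix.one_mulVec, Pi.single_apply]
  simp only [eq_comm]

namespace Wedge.IsCapillaryHypersurface

variable {W : Wedge n L} {θ : Fin L → ℝ} {S : Set (AmbientSpace n)}
  {ν : AmbientSpace n → AmbientSpace n}

theorem norm_normal (h : W.IsCapillaryHypersurface θ S ν) {x : AmbientSpace n} (hx : x ∈ S) :
    ‖ν x‖ = 1 := by
  obtain ⟨U, f, hU, hxU, hf, hg, hSU, hν⟩ := h.exists_local_equation x hx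
  rw [hν x ⟨hx, hxU⟩, norm_smul, norm_inv, norm_norm,
    inv_mul_cancel₀ (norm_ne_zero_iff.2 (hg x hxU))]

/-- A capillary hypersurface is locally the part in the wedge of a parametrized hypersurface. -/
theorem exists_chart (h : W.IsCapillaryHypersurface θ S ν) {x₀ : AmbientSpace n} (hx₀ : x₀ ∈ S) :
    ∃ (Z : Set (AmbientSpace n)) (ν' : AmbientSpace n → AmbientSpace n)
      (c : HypersurfaceChart Z ν'), x₀ ∈ c.V ∧ S ∩ c.V = W.region ∩ (Z ∩ c.V) ∧
        ∀ x ∈ S ∩ c.V, ν x = ν' x := by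
  obtain ⟨U, f, hU, hxU, hf, hg, hSU, hν⟩ := h.exists_local_equation x₀ hx₀
  have hfx₀ : f x₀ = 0 := by
    have h1 : x₀ ∈ S ∩ U := ⟨hx₀, hxU⟩
    rw [hSU] at h1
    exact h1.2
  obtain ⟨c, hc, hcU⟩ := exists_hypersurfaceChart hU hf hxU hfx₀ hg
  refine ⟨_, _, c, hc, ?_, fun x hx => hν x ⟨hx.1, hcU hx.2⟩⟩
  ext x
  constructor
  · rintro ⟨hxS, hxc⟩
    have h1 : x ∈ S ∩ U := ⟨hxS, hcU hxc⟩
    rw [hSU] at h1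
    exact ⟨h1.1.1, h1.2, hxc⟩
  · rintro ⟨hxW, hx0, hxc⟩
    have h1 : x ∈ S ∩ U := by
      rw [hSU]
      exact ⟨⟨hxW, hcU hxc⟩, hx0⟩
    exact ⟨h1.1, hxc⟩

/-- The version localized to one chart. The integral is pulled back to the compact parameter set of
`S ∩ tsupport Y`, where the density times the Jacobian is, up to the orientation, `mixedDet` of the
composed maps. -/
theorem setIntegral_surfaceMixedDet_chart (h : W.IsCapillaryHypersurface θ S ν)
    {Z : Set (AmbientSpace n)} {ν' : AmbientSpace n → AmbientSpace n} (c : HypersurfaceChart Z ν')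
    (hSc : S ∩ c.V = W.region ∩ (Z ∩ c.V)) (hν' : ∀ x ∈ S ∩ c.V, ν x = ν' x)
    {X Y : AmbientSpace n → AmbientSpace n}
    (hX : ∀ x ∈ S, ContDiffAt ℝ ∞ X x) (hY : ∀ x ∈ S, ContDiffAt ℝ ∞ Y x)
    (hXP : ∀ i, ∀ x ∈ S ∩ W.hyperplane i, ⟪X x, W.N i⟫ = 0)
    (hYP : ∀ i, ∀ x ∈ S ∩ W.hyperplane i, ⟪Y x, W.N i⟫ = 0) (hYc : tsupport Y ⊆ c.V) :
    IntegrableOn (fun x => surfaceMixedDet (ν x) (X x) (Y x) (fderiv ℝ X x) (fderiv ℝ Y x)) S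
        μHE[n] ∧
      ∫ x in S, surfaceMixedDet (ν x) (X x) (Y x) (fderiv ℝ X x) (fderiv ℝ Y x) ∂μHE[n] = 0 := by
  set G : AmbientSpace n → ℝ := fun x =>
    surfaceMixedDet (ν x) (X x) (Y x) (fderiv ℝ X x) (fderiv ℝ Y x) with hG
  set T := S ∩ tsupport Y with hT
  have hTc : IsCompact T := h.isCompact.inter_right (isClosed_tsupport Y)
  have hTV : ∀ x ∈ T, x ∈ S ∩ c.V := fun x hx => ⟨hx.1, hYc hx.2⟩
  have hTZ : ∀ x ∈ T, x ∈ Z ∩ c.V := fun x hx => by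
    have h1 := hTV x hx
    rw [hSc] at h1
    exact h1.2
  set K := c.π '' T with hK
  have hKc : IsCompact K := hTc.image c.π.continuous
  have hKO : K ⊆ c.O := by
    rintro _ ⟨x, hx, rfl⟩
    exact c.π_mem x (hTZ x hx)
  have hKT : ∀ u ∈ K, c.φ u ∈ T := by
    rintro _ ⟨x, hx, rfl⟩
    rwa [c.φ_π x (hTZ x hx)]
  have hφK : c.φ '' K = T := by
    ext x
    constructor
    · rintro ⟨u, hu, rfl⟩
      exact hKT u hu
    · intro hx
      exact ⟨c.π x, ⟨x, hx, rfl⟩, c.φ_π x (hTZ x hx)⟩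
  have hφd : ∀ u ∈ c.O, HasFDerivAt c.φ (fderiv ℝ c.φ u) u := fun u hu =>
    ((c.contDiffAt u hu).differentiableAt (by simp)).hasFDerivAt
  have hcomp : ∀ {Q : AmbientSpace n → AmbientSpace n}, (∀ x ∈ S, ContDiffAt ℝ ∞ Q x) →
      ∀ u ∈ K, fderiv ℝ (fun v => Q (c.φ v)) u = fderiv ℝ Q (c.φ u) ∘L fderiv ℝ c.φ u :=
    fun hQ u hu => (((hQ _ (hKT u hu).1).differentiableAt (by simp)).hasFDerivAt.comp u
      (hφd u (hKO hu))).fderiv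
  have hcompC : ∀ {Q : AmbientSpace n → AmbientSpace n}, (∀ x ∈ S, ContDiffAt ℝ ∞ Q x) →
      ∀ u ∈ K, ContDiffAt ℝ ∞ (fun v => Q (c.φ v)) u :=
    fun hQ u hu => (hQ _ (hKT u hu).1).comp u (c.contDiffAt u (hKO hu))
  let D : EuclideanSpace ℝ (Fin n) → ℝ := fun u =>
    detCons (ν' (c.φ u)) (fun k => fderiv ℝ c.φ u (EuclideanSpace.single k 1))
  let m : EuclideanSpace ℝ (Fin n) → ℝ := fun u =>
    mixedDet (X (c.φ u)) (Y (c.φ u)) (fderiv ℝ (fun v => X (c.φ v)) u)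
      (fderiv ℝ (fun v => Y (c.φ v)) u)
  have hm : ∀ u ∈ K, m u = D u * G (c.φ u) := by
    intro u hu
    simp only [m, hcomp hX u hu, hcomp hY u hu, G, D]
    rw [hν' _ (hTV _ (hKT u hu))]
    exact mixedDet_eq_detCons_mul_surfaceMixedDet (c.norm_normal u (hKO hu))
      (c.inner_normal u (hKO hu)) _ _ _ _
  have hDc : ContinuousOn D c.O := by
    refine ContinuousOn.detCons c.continuousOn_normal (continuousOn_pi.2 fun k => ?_)
    exact ContinuousOn.clm_apply (fun u hu =>
      ((c.contDiffAt u hu).fderiv_right (m := 0) (by simp)).continuousAt.continuousWithinAt)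
      continuousOn_const
  have hcont : ∀ {Q : AmbientSpace n → AmbientSpace n}, (∀ x ∈ S, ContDiffAt ℝ ∞ Q x) →
      ContinuousOn (fun u => Q (c.φ u)) K ∧ ContinuousOn (fderiv ℝ fun v => Q (c.φ v)) K :=
    fun hQ => ⟨fun u hu => (hcompC hQ u hu).continuousAt.continuousWithinAt, fun u hu =>
      ((hcompC hQ u hu).fderiv_right (m := 0) (by simp)).continuousAt.continuousWithinAt⟩
  have hmc : ContinuousOn m K :=
    ContinuousOn.mixedDet (hcont hX).1 (hcont hY).1 (hcont hX).2 (hcont hY).2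
  -- `tangentFrame` is chosen without continuity in `ν`, so the density is not visibly continuous.
  -- It is written as the quotient of two continuous functions, both computed in the chart frame.
  have hGc : ContinuousOn (fun u => G (c.φ u)) K := by
    have h1 : ContinuousOn (fun u => m u / D u) K :=
      hmc.div (hDc.mono hKO) fun u hu => c.det_ne_zero u (hKO hu)
    refine h1.congr fun u hu => ?_
    simp only [hm u hu]
    exact (mul_div_cancel_left₀ _ (c.det_ne_zero u (hKO hu))).symm
  obtain ⟨M, hM⟩ := W.exists_dual
  have hzero : ∫ u in K, m u = 0 := by
    refine setIntegral_mixedDet_eq_zero hM hKc (fun u hu => (hcompC hX u hu).of_le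
      (WithTop.coe_le_coe.2 (le_top : (2 : ℕ∞) ≤ ⊤))) (fun u hu => (hcompC hY u hu).of_le (by simp))
      fun u hu => ?_
    have hφu := hKT u hu
    -- At a point of some face, tangency to that one face suffices, even on an edge. At other points
    -- the parametrized hypersurface stays in the wedge nearby, so a parameter outside `K` can only
    -- mean leaving the support of `Y`.
    by_cases hi : ∃ i, ⟪c.φ u, W.N i⟫ = 0
    · obtain ⟨i, hi⟩ := hi
      exact Or.inr ⟨i, hXP i _ ⟨hφu.1, hi⟩, hYP i _ ⟨hφu.1, hi⟩⟩
    · left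
      push Not at hi
      have hneg : ∀ i, ∀ᶠ v in nhds u, ⟪c.φ v, W.N i⟫ < 0 := fun i => by
        have h1 : ContinuousAt (fun v => ⟪c.φ v, W.N i⟫) u :=
          (hφd u (hKO hu)).continuousAt.inner continuousAt_const
        exact h1.eventually_lt_const (lt_of_le_of_ne (h.subset_region hφu.1 i) (hi i))
      filter_upwards [Filter.eventually_all.2 hneg, c.isOpen_O.mem_nhds (hKO hu)] with v hv hvO hvK
      have hvS : c.φ v ∈ S ∩ c.V := by
        rw [hSc]
        exact ⟨fun i => (hv i).le, c.φ_mem v hvO⟩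
      have hvt : c.φ v ∉ tsupport Y := fun ht => hvK ⟨c.φ v, ⟨hvS.1, ht⟩, c.π_φ v hvO⟩
      exact image_eq_zero_of_notMem_tsupport hvt
  have harea := integrableOn_image_and_setIntegral_image c.isOpen_O c.volume_ne_top c.π_φ
    (fun u hu => (c.contDiffAt u hu).of_le (by simp)) c.lipschitzOnWith
    (j := fun u => c.σ * D u) (continuousOn_const.mul hDc)
    (fun u hu => (c.normDet_eq u hu).symm) hKc hKO hGc
  rw [hφK, finrank_euclideanSpace_fin] at harea
  have hGoff : ∀ x ∈ S \ T, G x = 0 := by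
    intro x hx
    have hxt : x ∉ tsupport Y := fun ht => hx.2 ⟨hx.1, ht⟩
    have h1 : Y =ᶠ[nhds x] fun _ => 0 := notMem_tsupport_iff_eventuallyEq.1 hxt
    have h2 : Y x = 0 := h1.self_of_nhds
    have h3 : fderiv ℝ Y x = 0 := by rw [h1.fderiv_eq]; simp
    simp only [G, h2, h3, surfaceMixedDet_zero]
  refine ⟨harea.1.of_forall_sdiff_eq_zero h.isCompact.measurableSet hGoff, ?_⟩
  rw [setIntegral_eq_of_subset_of_forall_sdiff_eq_zero h.isCompact.measurableSet
    inter_subset_left hGoff, harea.2]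
  have h1 : ∫ u in K, c.σ * D u * G (c.φ u) = ∫ u in K, c.σ * m u :=
    setIntegral_congr_fun hKc.measurableSet fun u hu => by
      simp only [hm u hu, mul_assoc]
  rw [h1, integral_const_mul, hzero, mul_zero]

/-- The divergence theorem on a capillary hypersurface for the flux of two vector fields that are
tangent to the faces of the wedge along the boundary. -/
theorem setIntegral_surfaceMixedDet_eq_zero (h : W.IsCapillaryHypersurface θ S ν)
    {X Y : AmbientSpace n → AmbientSpace n}
    (hX : ∀ x ∈ S, ContDiffAt ℝ ∞ X x) (hY : ∀ x ∈ S, ContDiffAt ℝ ∞ Y x)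
    (hXP : ∀ i, ∀ x ∈ S ∩ W.hyperplane i, ⟪X x, W.N i⟫ = 0)
    (hYP : ∀ i, ∀ x ∈ S ∩ W.hyperplane i, ⟪Y x, W.N i⟫ = 0) :
    IntegrableOn (fun x => surfaceMixedDet (ν x) (X x) (Y x) (fderiv ℝ X x) (fderiv ℝ Y x)) S
        μHE[n] ∧
      ∫ x in S, surfaceMixedDet (ν x) (X x) (Y x) (fderiv ℝ X x) (fderiv ℝ Y x) ∂μHE[n] = 0 := by
  choose Z ν' c hc hSc hν' using fun x : S => h.exists_chart x.2
  obtain ⟨t, hcover⟩ := h.isCompact.elim_finite_subcover (fun x => (c x).V)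
    (fun x => (c x).isOpen_V) fun x hx => mem_iUnion.2 ⟨⟨x, hx⟩, hc ⟨x, hx⟩⟩
  have hopen : IsOpen (⋃ x : t, (c x).V) := isOpen_iUnion fun x => (c x).isOpen_V
  -- The partition of unity has to sum to `1` on a neighbourhood of `S`, since derivatives of the
  -- pieces of `Y` are added up as well.
  obtain ⟨Q, hQ, hSQ, hQc⟩ := exists_compact_between h.isCompact hopen
    (by rwa [iUnion_subtype])
  obtain ⟨p, hp⟩ := SmoothPartitionOfUnity.exists_isSubordinate
    (modelWithCornersSelf ℝ (AmbientSpace n)) hQ.isClosed (fun x : t => (c x).V)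
    (fun x => (c x).isOpen_V) hQc
  have hpC : ∀ i, ContDiff ℝ ∞ (p i) := fun i => (p i).contMDiff.contDiff
  -- Only `Y` is localized: the density is additive in `Y` and its derivative jointly, and
  -- multiplication by a function preserves tangency to the faces.
  let y : t → AmbientSpace n → AmbientSpace n := fun i x => p i x • Y x
  have hyC : ∀ i, ∀ x ∈ S, ContDiffAt ℝ ∞ (y i) x := fun i x hx =>
    (hpC i).contDiffAt.smul (hY x hx)
  have hlocal : ∀ i : t, _ := fun i =>
    h.setIntegral_surfaceMixedDet_chart (c i) (hSc i) (hν' i) hX (hyC i) hXP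
      (fun j x hx => by simp only [y, real_inner_smul_left, hYP j x hx, mul_zero])
      ((tsupport_smul_subset_left (p i) Y).trans (hp i))
  have hsum : ∀ x ∈ S, surfaceMixedDet (ν x) (X x) (Y x) (fderiv ℝ X x) (fderiv ℝ Y x) =
      ∑ i : t, surfaceMixedDet (ν x) (X x) (y i x) (fderiv ℝ X x) (fderiv ℝ (y i) x) := by
    intro x hx
    have h1 : Y =ᶠ[nhds x] fun x => ∑ i : t, y i x := by
      filter_upwards [isOpen_interior.mem_nhds (hSQ hx)] with z hz
      have h2 := p.sum_eq_one (interior_subset hz)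
      rw [finsum_eq_sum_of_fintype] at h2
      simp only [y, ← Finset.sum_smul, h2, one_smul]
    rw [← surfaceMixedDet_sum, h1.fderiv_eq, h1.self_of_nhds,
      fderiv_fun_sum fun i _ => (hyC i x hx).differentiableAt (by simp)]
  refine ⟨(integrableOn_congr_fun hsum h.isCompact.measurableSet).2
    (integrable_finsetSum _ fun i _ => (hlocal i).1), ?_⟩
  rw [setIntegral_congr_fun h.isCompact.measurableSet hsum,
    integral_finsetSum _ fun i _ => (hlocal i).1]
  exact Finset.sum_eq_zero fun i _ => (hlocal i).2

end Wedge.IsCapillaryHypersurface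

end Surface

/-! ### Symmetry of the shape operator and its characteristic polynomial -/

section Curvature

variable {n L : ℕ}

theorem HypersurfaceChart.π_fderiv {Z : Set (AmbientSpace n)} {ν : AmbientSpace n → AmbientSpace n}
    (c : HypersurfaceChart Z ν) {u : EuclideanSpace ℝ (Fin n)} (hu : u ∈ c.O)
    (w : EuclideanSpace ℝ (Fin n)) : c.π (fderiv ℝ c.φ u w) = w := by
  have h1 : HasFDerivAt (fun v => c.π (c.φ v)) (c.π.comp (fderiv ℝ c.φ u)) u :=
    c.π.hasFDerivAt.comp u ((c.contDiffAt u hu).differentiableAt (by simp)).hasFDerivAt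
  have h2 : (fun v => c.π (c.φ v)) =ᶠ[nhds u] id := by
    filter_upwards [c.isOpen_O.mem_nhds hu] with v hv using c.π_φ v hv
  have h3 := (h1.congr_of_eventuallyEq h2.symm).unique (hasFDerivAt_id u)
  exact congrArg (fun A : EuclideanSpace ℝ (Fin n) →L[ℝ] EuclideanSpace ℝ (Fin n) => A w) h3

namespace Wedge.IsCapillaryHypersurface

variable {W : Wedge n L} {θ : Fin L → ℝ} {S : Set (AmbientSpace n)}
  {ν : AmbientSpace n → AmbientSpace n}

theorem contDiffAt_normal (h : W.IsCapillaryHypersurface θ S ν) {x : AmbientSpace n}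
    (hx : x ∈ S) : ContDiffAt ℝ ∞ ν x := by
  obtain ⟨V, hV, hSV, hν⟩ := h.contDiffOn_normal
  exact hν.contDiffAt (hV.mem_nhds (hSV hx))

/-- The part of `S` in the interior of the wedge is dense in `S`. -/
theorem eq_zero_of_eq_zero_on_interior (h : W.IsCapillaryHypersurface θ S ν)
    {g : AmbientSpace n → ℝ} (hg : ContinuousOn g S) (h0 : ∀ x ∈ S ∩ interior W.region, g x = 0)
    {x : AmbientSpace n} (hx : x ∈ S) : g x = 0 := by
  have h1 : ContinuousWithinAt g (S ∩ interior W.region) x := (hg x hx).mono inter_subset_left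
  have h2 := h1.mem_closure_image (h.subset_closure hx)
  have h3 : g '' (S ∩ interior W.region) ⊆ {0} := by
    rintro _ ⟨z, hz, rfl⟩
    exact h0 z hz
  simpa using closure_mono h3 h2

/-- At an interior point `ν` is the chart normal along the whole chart nearby, so `‖ν‖² = 1` and
`⟪ν, dφ w⟫ = 0` may be differentiated in every direction. The second relation gives `⟪dν (dφ v), dφ
w⟫ = -⟪ν, d²φ(v, w)⟫`, which is symmetric in `v` and `w`. -/
theorem inner_fderiv_normal_of_mem_interior (h : W.IsCapillaryHypersurface θ S ν)
    {x : AmbientSpace n} (hx : x ∈ S) (hxW : x ∈ interior W.region) :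
    (∀ a, ⟪ν x, a⟫ = 0 → ⟪ν x, fderiv ℝ ν x a⟫ = 0) ∧
      ∀ a b, ⟪ν x, a⟫ = 0 → ⟪ν x, b⟫ = 0 → ⟪fderiv ℝ ν x a, b⟫ = ⟪a, fderiv ℝ ν x b⟫ := by
  obtain ⟨Z, ν', c, hxc, hSc, hν'⟩ := h.exists_chart hx
  have hxZ : x ∈ Z ∩ c.V := by
    have h1 : x ∈ S ∩ c.V := ⟨hx, hxc⟩
    rw [hSc] at h1
    exact h1.2
  set u := c.π x with hu
  have huO : u ∈ c.O := c.π_mem x hxZ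
  have hφu : c.φ u = x := c.φ_π x hxZ
  have hφd : HasFDerivAt c.φ (fderiv ℝ c.φ u) u :=
    ((c.contDiffAt u huO).differentiableAt (by simp)).hasFDerivAt
  have hνd : HasFDerivAt ν (fderiv ℝ ν x) (c.φ u) := by
    rw [hφu]
    exact ((h.contDiffAt_normal hx).differentiableAt (by simp)).hasFDerivAt
  have hnear : ∀ᶠ v in nhds u, v ∈ c.O ∧ ν (c.φ v) = ν' (c.φ v) := by
    have h1 : ∀ᶠ v in nhds u, c.φ v ∈ interior W.region :=
      hφd.continuousAt.eventually_mem (isOpen_interior.mem_nhds (by rwa [hφu]))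
    filter_upwards [h1, c.isOpen_O.mem_nhds huO] with v hv hvO
    refine ⟨hvO, hν' _ ?_⟩
    rw [hSc]
    exact ⟨interior_subset hv, c.φ_mem v hvO⟩
  have hν'' : HasFDerivAt (fun v => ν (c.φ v)) (fderiv ℝ ν x ∘L fderiv ℝ c.φ u) u :=
    hνd.comp u hφd
  have hνx : ‖ν x‖ = 1 := h.norm_normal hx
  have hsurj : ∀ a, ⟪ν x, a⟫ = 0 → ∃ w, fderiv ℝ c.φ u w = a := by
    intro a ha
    refine exists_apply_eq_of_inner_eq_zero hνx (B := (fderiv ℝ c.φ u).toLinearMap)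
      (fun v w hvw => ?_) (fun w => ?_) ha
    · rw [← c.π_fderiv huO v, ← c.π_fderiv huO w]
      exact congrArg c.π hvw
    · have h1 := c.inner_normal u huO w
      rwa [← hnear.self_of_nhds.2, hφu] at h1
  constructor
  · intro a ha
    obtain ⟨w, rfl⟩ := hsurj a ha
    have h1 : HasFDerivAt (fun v => ⟪ν (c.φ v), ν (c.φ v)⟫) _ u := hν''.inner ℝ hν''
    have h2 : (fun v => ⟪ν (c.φ v), ν (c.φ v)⟫) =ᶠ[nhds u] fun _ => (1 : ℝ) := by
      filter_upwards [hnear] with v hv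
      rw [hv.2, real_inner_self_eq_norm_sq, c.norm_normal v hv.1, one_pow]
    have h3 := (h1.congr_of_eventuallyEq h2.symm).unique (hasFDerivAt_const (1 : ℝ) u)
    have h4 := congrArg (fun A : EuclideanSpace ℝ (Fin n) →L[ℝ] ℝ => A w) h3
    simp only [ContinuousLinearMap.comp_apply, ContinuousLinearMap.prod_apply,
      fderivInnerCLM_apply, zero_apply, hφu] at h4
    rw [real_inner_comm (ν x)] at h4
    linarith
  · have hkey : ∀ v w, ⟪fderiv ℝ ν x (fderiv ℝ c.φ u v), fderiv ℝ c.φ u w⟫ =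
        -⟪ν x, fderiv ℝ (fderiv ℝ c.φ) u v w⟫ := by
      intro v w
      have h0 : HasFDerivAt (fun z => fderiv ℝ c.φ z w)
          ((fderiv ℝ (fderiv ℝ c.φ) u).flip w) u := by
        have h1 : HasFDerivAt (fderiv ℝ c.φ) (fderiv ℝ (fderiv ℝ c.φ) u) u :=
          ((((c.contDiffAt u huO).of_le (WithTop.coe_le_coe.2 (le_top : (2 : ℕ∞) ≤ ⊤))).fderiv_right
            (m := 1) (by norm_num)).differentiableAt (by simp)).hasFDerivAt
        simpa using h1.clm_apply (hasFDerivAt_const w u)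
      have h1 : HasFDerivAt (fun z => ⟪ν (c.φ z), fderiv ℝ c.φ z w⟫) _ u := hν''.inner ℝ h0
      have h2 : (fun z => ⟪ν (c.φ z), fderiv ℝ c.φ z w⟫) =ᶠ[nhds u] fun _ => (0 : ℝ) := by
        filter_upwards [hnear] with z hz
        rw [hz.2, c.inner_normal z hz.1]
      have h3 := (h1.congr_of_eventuallyEq h2.symm).unique (hasFDerivAt_const (0 : ℝ) u)
      have h4 := congrArg (fun A : EuclideanSpace ℝ (Fin n) →L[ℝ] ℝ => A v) h3
      simp only [ContinuousLinearMap.comp_apply, ContinuousLinearMap.prod_apply,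
        fderivInnerCLM_apply, zero_apply, hφu, ContinuousLinearMap.flip_apply] at h4
      linarith
    have hsymm : ∀ v w, fderiv ℝ (fderiv ℝ c.φ) u v w = fderiv ℝ (fderiv ℝ c.φ) u w v :=
      fun v w => (((c.contDiffAt u huO).of_le
        (WithTop.coe_le_coe.2 (le_top : (2 : ℕ∞) ≤ ⊤))).isSymmSndFDerivAt (by simp)).eq v w
    intro a b ha hb
    obtain ⟨v, rfl⟩ := hsurj a ha
    obtain ⟨w, rfl⟩ := hsurj b hb
    rw [hkey v w, real_inner_comm (fderiv ℝ ν x (fderiv ℝ c.φ u w)) (fderiv ℝ c.φ u v), hkey w v,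
      hsymm]

/-- Extended from interior points by continuity. To keep the vectors tangent while the point varies,
fixed vectors are projected to the moving tangent space by `P`. -/
theorem inner_fderiv_normal (h : W.IsCapillaryHypersurface θ S ν) {x : AmbientSpace n}
    (hx : x ∈ S) :
    (∀ a, ⟪ν x, a⟫ = 0 → ⟪ν x, fderiv ℝ ν x a⟫ = 0) ∧
      ∀ a b, ⟪ν x, a⟫ = 0 → ⟪ν x, b⟫ = 0 → ⟪fderiv ℝ ν x a, b⟫ = ⟪a, fderiv ℝ ν x b⟫ := by
  have hνc : ContinuousOn ν S := fun z hz => (h.contDiffAt_normal hz).continuousAt.continuousWithinAt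
  have hν'c : ContinuousOn (fderiv ℝ ν) S := fun z hz =>
    ((h.contDiffAt_normal hz).fderiv_right (m := 0) (by simp)).continuousAt.continuousWithinAt
  let P : AmbientSpace n → AmbientSpace n → AmbientSpace n := fun a z => a - ⟪ν z, a⟫ • ν z
  have hPc : ∀ a, ContinuousOn (P a) S := fun a =>
    continuousOn_const.sub ((hνc.inner continuousOn_const).fun_smul hνc)
  have hP : ∀ a, ∀ z ∈ S, ⟪ν z, P a z⟫ = 0 := fun a z hz => by
    simp only [P]
    rw [inner_sub_right, real_inner_smul_right, real_inner_self_eq_norm_sq, h.norm_normal hz]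
    ring
  have hPx : ∀ a, ⟪ν x, a⟫ = 0 → P a x = a := fun a ha => by simp [P, ha]
  constructor
  · intro a ha
    have h1 := h.eq_zero_of_eq_zero_on_interior (g := fun z => ⟪ν z, fderiv ℝ ν z (P a z)⟫)
      (hνc.inner (hν'c.clm_apply (hPc a)))
      (fun z hz => (h.inner_fderiv_normal_of_mem_interior hz.1 hz.2).1 _ (hP a z hz.1)) hx
    simpa only [hPx a ha] using h1
  · intro a b ha hb
    have h1 := h.eq_zero_of_eq_zero_on_interior
      (g := fun z => ⟪fderiv ℝ ν z (P a z), P b z⟫ - ⟪P a z, fderiv ℝ ν z (P b z)⟫)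
      (((hν'c.clm_apply (hPc a)).inner (hPc b)).sub ((hPc a).inner (hν'c.clm_apply (hPc b))))
      (fun z hz => sub_eq_zero.2 ((h.inner_fderiv_normal_of_mem_interior hz.1 hz.2).2 _ _
        (hP a z hz.1) (hP b z hz.1))) hx
    simpa only [hPx a ha, hPx b hb, sub_eq_zero] using h1

end Wedge.IsCapillaryHypersurface

/-- The determinant of `1 + t T` in terms of the elementary symmetric functions of the
eigenvalues of the symmetric map `T`. -/
theorem LinearMap.IsSymmetric.det_one_add_smul {E : Type*} [NormedAddCommGroup E]
    [InnerProductSpace ℝ E] [FiniteDimensional ℝ E] {T : E →ₗ[ℝ] E} (hT : T.IsSymmetric)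
    (hn : Module.finrank ℝ E = n) (t : ℝ) :
    LinearMap.det (1 + t • T) =
      ∑ r ∈ Finset.range (n + 1), T.charpoly.roots.esymm r * t ^ r := by
  have h1 : LinearMap.det (1 + t • T) = ∏ i, (1 + t * hT.eigenvalues hn i) := by
    have h2 : LinearMap.toMatrix (hT.eigenvectorBasis hn).toBasis (hT.eigenvectorBasis hn).toBasis
        (1 + t • T) = Matrix.diagonal fun i => 1 + t * hT.eigenvalues hn i := by
      rw [map_add, map_smul, hT.toMatrix_eigenvectorBasis hn, LinearMap.toMatrix_one]
      ext i j
      by_cases hij : i = j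
      · subst hij; simp
      · simp [hij]
    rw [← LinearMap.det_toMatrix (hT.eigenvectorBasis hn).toBasis, h2, Matrix.det_diagonal]
  rw [h1, Finset.prod_one_add, Finset.sum_powerset, Finset.card_univ, Fintype.card_fin]
  refine Finset.sum_congr rfl fun r _ => ?_
  rw [hT.roots_charpoly_eq_eigenvalues hn, Finset.esymm_map_val, Finset.sum_mul]
  refine Finset.sum_congr rfl fun s hs => ?_
  rw [Finset.prod_mul_distrib, Finset.prod_const, (Finset.mem_powersetCard.1 hs).2, mul_comm]
  rfl

/-- The shape operator in the frame `tangentFrame ν`. -/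
noncomputable def frameShape (ν : AmbientSpace n) (A : AmbientSpace n →L[ℝ] AmbientSpace n) :
    EuclideanSpace ℝ (Fin n) →ₗ[ℝ] EuclideanSpace ℝ (Fin n) :=
  (ContinuousLinearMap.adjoint (tangentFrame ν).toContinuousLinearMap ∘L A ∘L
    (tangentFrame ν).toContinuousLinearMap).toLinearMap

theorem inner_frameShape (ν : AmbientSpace n) (A : AmbientSpace n →L[ℝ] AmbientSpace n)
    (v w : EuclideanSpace ℝ (Fin n)) :
    ⟪frameShape ν A v, w⟫ = ⟪A (tangentFrame ν v), tangentFrame ν w⟫ :=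
  ContinuousLinearMap.adjoint_inner_left (tangentFrame ν).toContinuousLinearMap w
    (A (tangentFrame ν v))

theorem tangentFrame_frameShape {ν : AmbientSpace n} (hν : ‖ν‖ = 1)
    {A : AmbientSpace n →L[ℝ] AmbientSpace n} (hA : ∀ a, ⟪ν, a⟫ = 0 → ⟪ν, A a⟫ = 0)
    (v : EuclideanSpace ℝ (Fin n)) :
    tangentFrame ν (frameShape ν A v) = A (tangentFrame ν v) := by
  obtain ⟨w, hw⟩ := exists_tangentFrame_eq hν (hA _ (inner_tangentFrame ν v))
  rw [← hw]
  congr 1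
  refine ext_inner_right ℝ fun z => ?_
  rw [inner_frameShape, ← hw, (tangentFrame ν).inner_map_map]

/-- Only the normal component of `a` matters: its tangential part lies in the same hyperplane as the
frame. -/
theorem detCons_tangentFrame_comp {ν : AmbientSpace n} (hν : ‖ν‖ = 1) (a : AmbientSpace n)
    (C : EuclideanSpace ℝ (Fin n) →ₗ[ℝ] EuclideanSpace ℝ (Fin n)) :
    detCons a (fun k => tangentFrame ν (C (EuclideanSpace.single k 1))) =
      LinearMap.det C * (⟪a, ν⟫ * frameSign ν) := by
  have hν0 : ν ≠ 0 := fun h => by simp [h] at hν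
  have h1 : detCons (a - ⟪a, ν⟫ • ν)
      (fun k => tangentFrame ν (EuclideanSpace.single k 1)) = 0 := by
    refine detCons_eq_zero_of_inner_eq_zero hν0 ?_ fun k => ?_
    · rw [inner_sub_left, real_inner_smul_left, real_inner_self_eq_norm_sq, hν]
      ring
    · rw [real_inner_comm]
      exact inner_tangentFrame ν _
  have h2 := detCons_add_left (a - ⟪a, ν⟫ • ν) (⟪a, ν⟫ • ν)
    (fun k => tangentFrame ν (EuclideanSpace.single k 1))
  rw [sub_add_cancel, h1, zero_add, detCons_smul_left] at h2
  rw [frameSign, ← h2]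
  exact detCons_comp a (tangentFrame ν).toLinearMap C

theorem principalCurvatures_eq_roots_frameShape {ν : AmbientSpace n → AmbientSpace n}
    {x : AmbientSpace n} (hν : ‖ν x‖ = 1)
    (hA : ∀ a, ⟪ν x, a⟫ = 0 → ⟪ν x, fderiv ℝ ν x a⟫ = 0) :
    principalCurvatures ν x = (frameShape (ν x) (fderiv ℝ ν x)).charpoly.roots := by
  let ι : EuclideanSpace ℝ (Fin n) →ₗ[ℝ] ((ℝ ∙ ν x)ᗮ : Submodule ℝ (AmbientSpace n)) :=
    (tangentFrame (ν x)).toLinearMap.codRestrict _ fun w =>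
      Submodule.mem_orthogonal_singleton_iff_inner_right.2 (inner_tangentFrame (ν x) w)
  have hι : Function.Bijective ι := by
    constructor
    · intro v w hvw
      exact (tangentFrame (ν x)).injective (congrArg Subtype.val hvw)
    · rintro ⟨w, hw⟩
      obtain ⟨v, hv⟩ := exists_tangentFrame_eq hν
        (Submodule.mem_orthogonal_singleton_iff_inner_right.1 hw)
      exact ⟨v, Subtype.ext hv⟩
  let e := LinearEquiv.ofBijective ι hι
  have h1 : shapeOperator ν x = e.conj (frameShape (ν x) (fderiv ℝ ν x)) := by
    refine LinearMap.ext fun w => ?_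
    obtain ⟨v, rfl⟩ := e.surjective w
    rw [LinearEquiv.conj_apply_apply, LinearEquiv.symm_apply_apply]
    have h2 : (e (frameShape (ν x) (fderiv ℝ ν x) v) : AmbientSpace n) =
        fderiv ℝ ν x (tangentFrame (ν x) v) := tangentFrame_frameShape hν hA v
    have h3 : shapeOperator ν x (e v) = (ℝ ∙ ν x)ᗮ.orthogonalProjectionOnto
        (fderiv ℝ ν x (tangentFrame (ν x) v)) := rfl
    rw [h3, ← h2, Submodule.orthogonalProjectionOnto_mem_subspace_eq_self]
  rw [principalCurvatures, h1, LinearEquiv.charpoly_conj]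

end Curvature

/-- If all the values of a polynomial with coefficients `g i` are integrable functions with
integral zero, then so are the coefficients. -/
theorem integrable_coeff_and_integral_coeff_eq_zero {α : Type*} [MeasurableSpace α]
    {μ : Measure α} {n : ℕ} {g : Fin n → α → ℝ}
    (h : ∀ t : ℝ, Integrable (fun x => ∑ i : Fin n, t ^ (i : ℕ) * g i x) μ ∧
      ∫ x, ∑ i : Fin n, t ^ (i : ℕ) * g i x ∂μ = 0) (i : Fin n) :
    Integrable (g i) μ ∧ ∫ x, g i x ∂μ = 0 := by
  -- Evaluation at the `n` distinct nodes `0, …, n - 1` determines the coefficients by inverting the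
  -- Vandermonde matrix.
  let V : Matrix (Fin n) (Fin n) ℝ := Matrix.vandermonde fun k => ((k : ℕ) : ℝ)
  have hV : IsUnit V.det := by
    refine (Matrix.det_vandermonde_ne_zero_iff.2 fun j k hjk => ?_).isUnit
    exact Fin.ext (Nat.cast_injective hjk)
  have hg : g i = fun x => ∑ k : Fin n, V⁻¹ i k * ∑ j : Fin n, ((k : ℕ) : ℝ) ^ (j : ℕ) * g j x := by
    funext x
    have h1 : (V⁻¹.mulVec (V.mulVec fun j => g j x)) i = g i x := by
      rw [Matrix.mulVec_mulVec, Matrix.nonsing_inv_mul _ hV, Matrix.one_mulVec]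
    rw [← h1]
    rfl
  have hint : ∀ k ∈ Finset.univ, Integrable
      (fun x => V⁻¹ i k * ∑ j : Fin n, ((k : ℕ) : ℝ) ^ (j : ℕ) * g j x) μ :=
    fun k _ => (h _).1.const_mul _
  rw [hg]
  refine ⟨integrable_finsetSum _ hint, ?_⟩
  rw [integral_finsetSum _ hint]
  refine Finset.sum_eq_zero fun k _ => ?_
  rw [integral_const_mul, (h _).2, mul_zero]

/-! ### Parallel displacement and the Minkowski formulas -/

section Minkowski

variable {n L : ℕ}

namespace Wedge.IsCapillaryHypersurface

variable {W : Wedge n L} {θ : Fin L → ℝ} {S : Set (AmbientSpace n)}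
  {ν : AmbientSpace n → AmbientSpace n}

theorem det_one_add_smul_frameShape (h : W.IsCapillaryHypersurface θ S ν) {x : AmbientSpace n}
    (hx : x ∈ S) (s : ℝ) :
    LinearMap.det (1 + s • frameShape (ν x) (fderiv ℝ ν x)) =
      ∑ r ∈ Finset.range (n + 1), (principalCurvatures ν x).esymm r * s ^ r := by
  obtain ⟨h1, h2⟩ := h.inner_fderiv_normal hx
  rw [principalCurvatures_eq_roots_frameShape (h.norm_normal hx) h1]
  refine LinearMap.IsSymmetric.det_one_add_smul (fun v w => ?_) (by simp) s
  rw [inner_frameShape, h2 _ _ (inner_tangentFrame _ v) (inner_tangentFrame _ w),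
    real_inner_comm, ← inner_frameShape, real_inner_comm]

/-- Steiner's formula: displacing the tangent frame by `s dν` multiplies the area element by `det (1
+ s dν) = ∑ σ_r(κ) s^r`. -/
theorem detCons_add_smul_tangentFrame (h : W.IsCapillaryHypersurface θ S ν) {x : AmbientSpace n}
    (hx : x ∈ S) (z : AmbientSpace n) (s : ℝ) :
    detCons z (fun k => tangentFrame (ν x) (EuclideanSpace.single k 1) +
        s • fderiv ℝ ν x (tangentFrame (ν x) (EuclideanSpace.single k 1))) =
      (∑ r ∈ Finset.range (n + 1), (principalCurvatures ν x).esymm r * s ^ r) *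
        (⟪z, ν x⟫ * frameSign (ν x)) := by
  rw [← h.det_one_add_smul_frameShape hx, ← detCons_tangentFrame_comp (h.norm_normal hx)]
  congr 1
  funext k
  rw [LinearMap.add_apply, LinearMap.smul_apply, map_add, map_smul,
    tangentFrame_frameShape (h.norm_normal hx) (h.inner_fderiv_normal hx).1]
  rfl

/-- With `P(s) = ∑ e_r s^r`, `a = ⟪x, ν⟫` and `c = ⟪y, ν⟫`, the determinant of the displaced vectors
is `P(s) (a + sc)` up to the frame sign. Its derivative at `t`, minus the term `P c` from moving the
first vector, is the sum in `mixedDet`. The density is thus `P'(t) (a + tc) - n c P(t) = a P' + c (t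
P' - n P)`. -/
theorem surfaceMixedDet_parallel (h : W.IsCapillaryHypersurface θ S ν) {x : AmbientSpace n}
    (hx : x ∈ S) (y : AmbientSpace n) (t : ℝ) :
    surfaceMixedDet (ν x) (x + t • y) y (ContinuousLinearMap.id ℝ _ + t • fderiv ℝ ν x)
        (fderiv ℝ ν x) =
      ∑ i : Fin n, t ^ (i : ℕ) * (((i : ℕ) + 1) * n.choose (i + 1) *
        (meanCurvature (i + 1) ν x * ⟪x, ν x⟫ - meanCurvature i ν x * ⟪y, ν x⟫)) := by
  set e : ℕ → ℝ := fun r => (principalCurvatures ν x).esymm r with he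
  set a := ⟪x, ν x⟫ with ha
  set c := ⟪y, ν x⟫ with hc
  let v : Fin n → AmbientSpace n := fun k => tangentFrame (ν x) (EuclideanSpace.single k 1)
  let w : Fin n → AmbientSpace n := fun k => fderiv ℝ ν x (v k)
  have hsign := frameSign_mul_self (h.norm_normal hx)
  have h1 := hasDerivAt_detCons_add_smul x y v w t
  have h2 : (fun s : ℝ => detCons (x + s • y) fun k => v k + s • w k) = fun s =>
      (∑ r ∈ Finset.range (n + 1), e r * s ^ r) * ((a + s * c) * frameSign (ν x)) := by
    funext s
    refine (h.detCons_add_smul_tangentFrame hx _ s).trans ?_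
    rw [inner_add_left, real_inner_smul_left]
  have h3 : HasDerivAt (fun s : ℝ =>
      (∑ r ∈ Finset.range (n + 1), e r * s ^ r) * ((a + s * c) * frameSign (ν x)))
      ((∑ r ∈ Finset.range (n + 1), e r * ((r : ℝ) * t ^ (r - 1))) *
        ((a + t * c) * frameSign (ν x)) +
        (∑ r ∈ Finset.range (n + 1), e r * t ^ r) * (c * frameSign (ν x))) t := by
    refine (HasDerivAt.fun_sum fun r _ => (hasDerivAt_pow r t).const_mul (e r)).mul
      ((((hasDerivAt_id t).mul_const c).const_add a).mul_const _) |>.congr_deriv ?_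
    simp
  rw [h2] at h1
  have h4 := h1.unique h3
  rw [h.detCons_add_smul_tangentFrame hx y t, ← hc] at h4
  have h5 : mixedDet (x + t • y) y
      ((ContinuousLinearMap.id ℝ _ + t • fderiv ℝ ν x) ∘L
        (tangentFrame (ν x)).toContinuousLinearMap)
      (fderiv ℝ ν x ∘L (tangentFrame (ν x)).toContinuousLinearMap) =
      -(n : ℝ) * detCons y (fun k => v k + t • w k) +
        ∑ k, detCons (x + t • y) (Function.update (fun j => v j + t • w j) k (w k)) := rfl
  have h6 : detCons y (fun k => v k + t • w k) = _ := h.detCons_add_smul_tangentFrame hx y t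
  have h7 : surfaceMixedDet (ν x) (x + t • y) y
      (ContinuousLinearMap.id ℝ _ + t • fderiv ℝ ν x) (fderiv ℝ ν x) =
      (∑ r ∈ Finset.range (n + 1), e r * ((r : ℝ) * t ^ (r - 1))) * (a + t * c) -
        n * c * ∑ r ∈ Finset.range (n + 1), e r * t ^ r := by
    rw [surfaceMixedDet, h5, h6, ← hc]
    linear_combination frameSign (ν x) * h4 +
      ((∑ r ∈ Finset.range (n + 1), e r * ((r : ℝ) * t ^ (r - 1))) * (a + t * c) -
        n * c * ∑ r ∈ Finset.range (n + 1), e r * t ^ r) * hsign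
  have h8 : ∑ r ∈ Finset.range (n + 1), e r * ((r : ℝ) * t ^ (r - 1)) =
      ∑ i ∈ Finset.range n, t ^ i * ((i + 1) * e (i + 1)) := by
    rw [Finset.sum_range_succ']
    simp only [Nat.cast_zero, zero_mul, mul_zero, add_zero, Nat.add_sub_cancel, Nat.cast_add,
      Nat.cast_one]
    exact Finset.sum_congr rfl fun i _ => by ring
  -- Euler's operator removes the top degree `n`, so that `n` coefficients remain.
  have h9 : t * ∑ r ∈ Finset.range (n + 1), e r * ((r : ℝ) * t ^ (r - 1)) -
      n * ∑ r ∈ Finset.range (n + 1), e r * t ^ r =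
      -∑ i ∈ Finset.range n, t ^ i * ((n - i) * e i) := by
    rw [Finset.mul_sum, Finset.mul_sum, ← Finset.sum_sub_distrib, Finset.sum_range_succ,
      ← Finset.sum_neg_distrib]
    have h10 : ∀ r : ℕ, t * (e r * ((r : ℝ) * t ^ (r - 1))) - n * (e r * t ^ r) =
        -(t ^ r * ((n - r) * e r)) := by
      intro r
      rcases r with _ | r
      · simp
      · rw [Nat.add_sub_cancel, pow_succ]
        ring
    simp only [h10]
    simp
  have h11 : ∀ r ≤ n, e r = n.choose r * meanCurvature r ν x := fun r hr => by
    have : (n.choose r : ℝ) ≠ 0 := Nat.cast_ne_zero.2 (Nat.choose_pos hr).ne'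
    rw [meanCurvature, mul_div_cancel₀ _ this]
  have h12 : surfaceMixedDet (ν x) (x + t • y) y
      (ContinuousLinearMap.id ℝ _ + t • fderiv ℝ ν x) (fderiv ℝ ν x) =
      a * (∑ i ∈ Finset.range n, t ^ i * ((i + 1) * e (i + 1))) +
        c * -∑ i ∈ Finset.range n, t ^ i * ((n - i) * e i) := by
    rw [← h9, h7, ← h8]
    ring
  rw [h12, Fin.sum_univ_eq_sum_range (fun i => t ^ i * (((i : ℝ) + 1) * n.choose (i + 1) *
        (meanCurvature (i + 1) ν x * a - meanCurvature i ν x * c))),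
    ← Finset.sum_neg_distrib, Finset.mul_sum, Finset.mul_sum, ← Finset.sum_add_distrib]
  refine Finset.sum_congr rfl fun i hi => ?_
  have hin : i < n := Finset.mem_range.1 hi
  -- This identity matches the two families of coefficients, so that one factor `(i + 1) (n choose i
  -- + 1)` comes out of both.
  have hchoose : (n.choose (i + 1) : ℝ) * (i + 1) = n.choose i * (n - i) := by
    have := Nat.choose_succ_right_eq n i
    rw [← Nat.cast_sub hin.le]
    exact_mod_cast this
  rw [h11 _ hin, h11 _ hin.le]
  linear_combination c * t ^ i * meanCurvature i ν x * hchoose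

theorem integrableOn_and_setIntegral_minkowski (h : W.IsCapillaryHypersurface θ S ν) {r : ℕ}
    (hr : 1 ≤ r) (hrn : r ≤ n) :
    IntegrableOn (fun x => meanCurvature (r - 1) ν x * (1 + ⟪ν x, W.capillaryVector θ⟫)
        - meanCurvature r ν x * ⟪x, ν x⟫) S μHE[n] ∧
    ∫ x in S, (meanCurvature (r - 1) ν x * (1 + ⟪ν x, W.capillaryVector θ⟫)
        - meanCurvature r ν x * ⟪x, ν x⟫) ∂μHE[n] = 0 := by
  obtain ⟨i, rfl⟩ : ∃ i, r = i + 1 := ⟨r - 1, by omega⟩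
  let Y : AmbientSpace n → AmbientSpace n := fun x => ν x + W.capillaryVector θ
  have hY : ∀ x ∈ S, ContDiffAt ℝ ∞ Y x := fun x hx =>
    (h.contDiffAt_normal hx).add contDiffAt_const
  have hYP : ∀ i, ∀ x ∈ S ∩ W.hyperplane i, ⟪Y x, W.N i⟫ = 0 := fun i x hx => by
    simp only [Y]
    rw [inner_add_left, h.contact_angle i x hx, W.inner_capillaryVector, neg_add_cancel]
  have hYd : ∀ x ∈ S, HasFDerivAt Y (fderiv ℝ ν x) x := fun x hx =>
    ((h.contDiffAt_normal hx).differentiableAt (by simp)).hasFDerivAt.add_const _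
  have hYν : ∀ x ∈ S, ⟪Y x, ν x⟫ = 1 + ⟪ν x, W.capillaryVector θ⟫ := fun x hx => by
    simp only [Y]
    rw [inner_add_left, real_inner_self_eq_norm_sq, h.norm_normal hx, one_pow, real_inner_comm]
  let g : Fin n → AmbientSpace n → ℝ := fun i x => ((i : ℕ) + 1) * n.choose (i + 1) *
        (meanCurvature (i + 1) ν x * ⟪x, ν x⟫ - meanCurvature i ν x * ⟪Y x, ν x⟫)
  have hg : ∀ t : ℝ, Integrable (fun x => ∑ i : Fin n, t ^ (i : ℕ) * g i x) (μHE[n].restrict S) ∧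
      ∫ x, ∑ i : Fin n, t ^ (i : ℕ) * g i x ∂(μHE[n].restrict S) = 0 := by
    intro t
    -- The displaced position `x + tY` remains tangent to each face because both `x` and `Y` are, so
    -- the divergence theorem applies for every `t`.
    have h1 := h.setIntegral_surfaceMixedDet_eq_zero (X := fun x => x + t • Y x) (Y := Y)
      (fun x hx => contDiffAt_id.add (contDiffAt_const.fun_smul (hY x hx))) hY
      (fun i x hx => by
        rw [inner_add_left, real_inner_smul_left, hYP i x hx, mul_zero, add_zero]
        exact hx.2) hYP
    have h2 : ∀ x ∈ S, surfaceMixedDet (ν x) (x + t • Y x) (Y x)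
        (fderiv ℝ (fun x => x + t • Y x) x) (fderiv ℝ Y x) = ∑ i : Fin n, t ^ (i : ℕ) * g i x := by
      intro x hx
      have h3 : HasFDerivAt (fun x => x + t • Y x)
          (ContinuousLinearMap.id ℝ _ + t • fderiv ℝ ν x) x :=
        (hasFDerivAt_id x).add ((hYd x hx).const_smul t)
      rw [h3.fderiv, (hYd x hx).fderiv]
      exact h.surfaceMixedDet_parallel hx (Y x) t
    exact ⟨h1.1.congr_fun h2 h.isCompact.measurableSet,
      (setIntegral_congr_fun h.isCompact.measurableSet h2).symm.trans h1.2⟩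
  -- With `r = i + 1`, the coefficient of `t ^ i` is `-q` times the integrand of the claim, where `q
  -- = r (n choose r) ≠ 0`.
  obtain ⟨hgi, hg0⟩ := integrable_coeff_and_integral_coeff_eq_zero hg ⟨i, hrn⟩
  set q : ℝ := (i + 1) * n.choose (i + 1) with hq
  have hq0 : q ≠ 0 := mul_ne_zero (by positivity) (Nat.cast_ne_zero.2 (Nat.choose_pos hrn).ne')
  have hI : ∀ x ∈ S, -q⁻¹ * g ⟨i, hrn⟩ x =
      meanCurvature (i + 1 - 1) ν x * (1 + ⟪ν x, W.capillaryVector θ⟫)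
        - meanCurvature (i + 1) ν x * ⟪x, ν x⟫ := by
    intro x hx
    simp only [g, hYν x hx, Nat.add_sub_cancel, ← hq]
    field_simp
    ring
  refine ⟨IntegrableOn.congr_fun (hgi.const_mul (-q⁻¹)) hI h.isCompact.measurableSet, ?_⟩
  rw [← setIntegral_congr_fun h.isCompact.measurableSet hI, integral_const_mul, hg0, mul_zero]

end Wedge.IsCapillaryHypersurface

theorem capillaryVector_halfSpaceWedge (n : ℕ) (θ₀ : ℝ) :
    (halfSpaceWedge n).capillaryVector (fun _ => θ₀) = -Real.cos θ₀ • lastBasisVector n := by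
  rw [← (halfSpaceWedge n).eq_capillaryVector _ (fun _ => Real.cos θ₀)]
  · simp [halfSpaceWedge]
  · intro i
    simp [halfSpaceWedge, lastBasisVector, real_inner_smul_left]

end Minkowski

theorem proposition2p3 (n : ℕ) (hn : 2 ≤ n) :
    (∀ (L : ℕ) (_ : 1 ≤ L) (W : Wedge n L) (θ : Fin L → ℝ) (_ : ∀ i, θ i ∈ Set.Ioo 0 Real.pi)
      (S : Set (AmbientSpace n)) (ν : AmbientSpace n → AmbientSpace n)
      (_ : W.IsCapillaryHypersurface θ S ν) (r : ℕ) (_ : 1 ≤ r) (_ : r ≤ n),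
      IntegrableOn (fun x => meanCurvature (r - 1) ν x * (1 + ⟪ν x, W.capillaryVector θ⟫)
          - meanCurvature r ν x * ⟪x, ν x⟫) S μHE[n] ∧
      ∫ x in S, (meanCurvature (r - 1) ν x * (1 + ⟪ν x, W.capillaryVector θ⟫)
          - meanCurvature r ν x * ⟪x, ν x⟫) ∂μHE[n] = 0) ∧
    (∀ (θ₀ : ℝ) (_ : θ₀ ∈ Set.Ioo 0 Real.pi)
      (S : Set (AmbientSpace n)) (ν : AmbientSpace n → AmbientSpace n)
      (_ : (halfSpaceWedge n).IsCapillaryHypersurface (fun _ => θ₀) S ν)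
      (r : ℕ) (_ : 1 ≤ r) (_ : r ≤ n),
      IntegrableOn (fun x => meanCurvature (r - 1) ν x *
            (1 - Real.cos θ₀ * ⟪ν x, lastBasisVector n⟫)
          - meanCurvature r ν x * ⟪x, ν x⟫) S μHE[n] ∧
      ∫ x in S, (meanCurvature (r - 1) ν x * (1 - Real.cos θ₀ * ⟪ν x, lastBasisVector n⟫)
          - meanCurvature r ν x * ⟪x, ν x⟫) ∂μHE[n] = 0) := by
  refine ⟨fun L _ W θ _ S ν h r hr hrn => h.integrableOn_and_setIntegral_minkowski hr hrn,
    fun θ₀ _ S ν h r hr hrn => ?_⟩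
  have h1 := h.integrableOn_and_setIntegral_minkowski hr hrn
  simpa only [capillaryVector_halfSpaceWedge, real_inner_smul_right, neg_mul, ← sub_eq_add_neg]
    using h1
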